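/- Let $d \ge 1$, $\nu > 0$, and let $P = \frac12(\nu^2|x|^2 - \Delta)$ be the isotropic harmonic oscillator, the self-adjoint operator on $L^2(\mathbf{R}^d)$ obtained as the closure of this differential operator with domain $C_c^\infty(\mathbf{R}^d)$. For measurable $\omega \subset \mathbf{R}^d$ and $T > 0$, let $\mathrm{Obs}(\omega, T)$ be the property that there is $C > 0$ such that $$\|u\|_{L^2(\mathbf{R}^d)}^2 \le C \int_0^T \|e^{-itP}u\|_{L^2(\omega)}^2 \, dt \qquad \text{for all } u \in L^2(\mathbf{R}^d),$$ say that the Schrödinger equation $i\partial_t\psi = P\psi$ is observable from $\omega$ if $\mathrm{Obs}(\omega,T)$ holds for some $T > 0$, and let $T_\star(\omega)$ be the infimum of the times $T>0$ such that $\mathrm{Obs}(\omega,T)$ holds. Let $\sigma$ be the uniform probability measure on the unit sphere $\mathbf{S}^{d-1}$, and for measurable $\Sigma \subset \mathbf{S}^{d-1}$ define the conical set $\omega(\Sigma) = \{x \in \mathbf{R}^d\setminus\{0\} : x/|x| \in \Sigma\}$ and the lower density $$\Theta^-_\Sigma(\theta) = \liminf_{r \to 0^+} \frac{\sigma(\Sigma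 \cap B_r(\theta))}{\sigma(B_r(\theta))}, \qquad \theta \in \mathbf{S}^{d-1},$$ where $B_r(\theta)$ is the ball of $\mathbf{R}^d$ of centre $\theta$ and radius $r$ and $\sigma(B_r(\theta))$ means $\sigma(\mathbf{S}^{d-1}\cap B_r(\theta))$. Let $\Sigma \subset \mathbf{S}^{d-1}$ be measurable and set $\widehat\Sigma = \Sigma \cup (-\Sigma)$. (i) If the Schrödinger equation is observable from $\omega(\Sigma)$, then $\inf_{\mathbf{S}^{d-1}} \Theta^-_{\widehat\Sigma} > 0$. (ii) The set $\widehat\Sigma$ has full measure, i.e. $\sigma(\mathbf{S}^{d-1}\setminus\widehat\Sigma) = 0$, if and only if $\Theta^-_{\widehat\Sigma}(\theta) = 1$ for all $\theta \in \mathbf{S}^{d-1}$. In that case the Schrödinger equation is observable from $\omega(\Sigma)$, and $T_\star(\omega(\Sigma)) < 2\pi/\nu$. -/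

import Mathlib

open MeasureTheory Metric Set Filter Topology
open scoped ENNReal Laplacian

/-- The configuration space `ℝ^d` with its Euclidean norm. -/
abbrev Rd (d : ℕ) : Type := EuclideanSpace ℝ (Fin d)

/-- The complex Hilbert space `L²(ℝ^d)`. -/
abbrev L2 (d : ℕ) : Type := Lp ℂ 2 (volume : Measure (Rd d))

/-- The differential expression `½ (ν² |x|² φ - Δ φ)`. -/
noncomputable def oscillatorExpr {d : ℕ} (ν : ℝ) (φ : Rd d → ℂ) : Rd d → ℂ :=
  fun x ↦ (1 / 2 : ℂ) * ((ν : ℂ) ^ 2 * (‖x‖ : ℂ) ^ 2 * φ x - (Δ φ) x)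

/-- The graph, in `L² × L²`, of `½ (ν² |x|² - Δ)` with domain `C_c^∞(ℝ^d)`. -/
def testGraph (d : ℕ) (ν : ℝ) : Set (L2 d × L2 d) :=
  {p | ∃ φ : Rd d → ℂ, ContDiff ℝ ((⊤ : ℕ∞) : WithTop ℕ∞) φ ∧ HasCompactSupport φ ∧
    p.1 =ᵐ[volume] φ ∧ p.2 =ᵐ[volume] oscillatorExpr ν φ}

/-- The graph of the self-adjoint operator `P = ½ (ν² |x|² - Δ)` on `L²(ℝ^d)`, i.e. of the closure
of the operator with domain `C_c^∞(ℝ^d)`: `(u, v) ∈ oscillatorGraph d ν` means that `u` is in the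
domain of `P` and `P u = v`. -/
def oscillatorGraph (d : ℕ) (ν : ℝ) : Set (L2 d × L2 d) :=
  closure (testGraph d ν)

/-- `U` is the strongly continuous one-parameter unitary group `t ↦ e^{-itP}`, that is, the one
whose infinitesimal generator is exactly `-iP`. -/
structure IsSchrodingerGroup {d : ℕ} (ν : ℝ) (U : ℝ → L2 d →L[ℂ] L2 d) : Prop where
  unitary : ∀ t, U t ∈ unitary (L2 d →L[ℂ] L2 d)
  zero : U 0 = 1
  add : ∀ s t, U (s + t) = U s * U t
  continuous : ∀ u, Continuous fun t ↦ U t u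
  generator : ∀ u v,
    (u, v) ∈ oscillatorGraph d ν ↔ HasDerivAt (fun t ↦ U t u) ((-Complex.I) • v) 0

open Classical in
/-- The propagator `e^{-itP}` of the Schrödinger equation `i ∂_t ψ = P ψ`. (The group exists and is
unique, `P` being self-adjoint; if it did not exist, this would be `0` and nothing would be
observable.) -/
noncomputable def propagator (d : ℕ) (ν : ℝ) : ℝ → L2 d →L[ℂ] L2 d :=
  if h : ∃ U : ℝ → L2 d →L[ℂ] L2 d, IsSchrodingerGroup ν U then h.choose else 0

/-- The observability inequality `Obs(ω, T)`. -/
def Observable {d : ℕ} (ν : ℝ) (ω : Set (Rd d)) (T : ℝ) : Prop :=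
  ∃ C : ℝ, 0 < C ∧ ∀ u : L2 d,
    ‖u‖ ^ 2 ≤ C * ∫ t in (0 : ℝ)..T, ∫ x in ω, ‖propagator d ν t u x‖ ^ 2

/-- The optimal observation time, the infimum of the times `T > 0` for which `Obs(ω, T)` holds
(meaningful when there is such a time). -/
noncomputable def optimalTime {d : ℕ} (ν : ℝ) (ω : Set (Rd d)) : ℝ :=
  sInf {T : ℝ | 0 < T ∧ Observable ν ω T}

/-- The unit sphere `S^{d-1}` of `ℝ^d`. -/
abbrev Sph (d : ℕ) : Type := sphere (0 : Rd d) 1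

/-- The uniform probability measure on the unit sphere: normalized surface measure. -/
noncomputable def sphereProb (d : ℕ) : Measure (Sph d) :=
  ((volume : Measure (Rd d)).toSphere univ)⁻¹ • (volume : Measure (Rd d)).toSphere

/-- The conical set `ω(S) = {x ≠ 0 | x / |x| ∈ S}`. -/
def cone {d : ℕ} (S : Set (Sph d)) : Set (Rd d) :=
  {x | x ≠ 0 ∧ ‖x‖⁻¹ • x ∈ ((↑) '' S : Set (Rd d))}

/-- The symmetrized set `S ∪ -S`. -/
def symmetrized {d : ℕ} (S : Set (Sph d)) : Set (Sph d) :=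
  S ∪ {θ | -θ ∈ S}

/-- The lower density of `S` at `θ`. The balls are those of the distance on the sphere
induced by the Euclidean one, i.e. the traces on the sphere of the balls of `ℝ^d`. -/
noncomputable def lowerDensity {d : ℕ} (S : Set (Sph d)) (θ : Sph d) : ℝ≥0∞ :=
  liminf (fun r : ℝ ↦ sphereProb d (S ∩ ball θ r) / sphereProb d (ball θ r)) (𝓝[>] 0)

/-! The whole argument rests on coherent states. With the normalization of `coherent`, the flow of
the oscillator only multiplies the parameter by `exp (-iνt)` and adds the zero-point phase. A state
started at rest at `Rθ` therefore has, at time `t`, a squared modulus proportional to `exp (-ν |x -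
R cos (νt) θ|²)`: it oscillates along the line of `θ` through the origin with constant width, and
sees the cone only near the directions `±θ`.

Necessity (`lowerDensity_lower_bound_of_observable`). Suppose that the symmetrized set has density
below `η` at scale `r` around `θ`. Choose `A` so large that the Gaussian mass farther than `A` from
the centre is negligible, and `R = 2A / (εr)`. As long as `|cos (νt)| ≥ ε`, the ball of radius `A`
around the centre is contained in the cone over the cap of radius `r` around `θ` or `-θ`, so the
state meets the cone in volume `O(η)`, uniformly in `r`. The remaining times have small measure. The
observability constant thus bounds `η` from below, uniformly in `θ`.

Full measure. Density one everywhere forces full measure by the Lebesgue density theorem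
(`full_of_lowerDensity_eq_one`). It applies because surface measure is doubling, which follows from
comparing conical shells with Euclidean balls. For observability, after half a period `π/ν` the
propagator is the reflection `x ↦ -x` up to a phase (`propagator_half_period`). Observing a cone at
times `t` and `t + π/ν` amounts to observing the cone and its opposite at time `t`, hence almost all
of space. A time slightly longer than `π/ν` is enough.

Since `propagator` is chosen among all groups with the right generator, such a group must first be
produced. The explicit evolution preserves the Gram matrix of the coherent states, which span a
dense subspace, so it extends to a unitary group. Its generator is the closure of the operator on
test functions by von Neumann's range criterion (`mem_oscillatorGraph_of_hasDerivAt`). Finally,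
every such group acts on coherent states by the explicit formula (`IsSchrodingerGroup.apply_cohLp`).
-/

/-! ### Gaussian envelopes and coherent states -/

/-- The function `exp (-ν |x|² / 2 + R |x|)`, which dominates all coherent states. -/
noncomputable def envelope {d : ℕ} (ν R : ℝ) (x : Rd d) : ℝ :=
  Real.exp (-(ν / 2) * ‖x‖ ^ 2 + R * ‖x‖)

lemma envelope_nonneg {d : ℕ} (ν R : ℝ) (x : Rd d) : 0 ≤ envelope ν R x := (Real.exp_pos _).le

lemma continuous_envelope {d : ℕ} (ν R : ℝ) : Continuous (envelope (d := d) ν R) := by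
  unfold envelope; fun_prop

lemma envelope_mono {d : ℕ} (ν : ℝ) {R R' : ℝ} (h : R ≤ R') (x : Rd d) :
    envelope ν R x ≤ envelope ν R' x := by
  unfold envelope; gcongr

/-- Each power of `1 + ‖x‖` costs one unit of `R`; all polynomial factors below are absorbed this
way. -/
lemma one_add_norm_mul_envelope_le {d : ℕ} (ν R : ℝ) (x : Rd d) :
    (1 + ‖x‖) * envelope ν R x ≤ envelope ν (R + 1) x := by
  have h : 1 + ‖x‖ ≤ Real.exp ‖x‖ := by linarith [Real.add_one_le_exp ‖x‖]
  calc (1 + ‖x‖) * envelope ν R x ≤ Real.exp ‖x‖ * envelope ν R x := by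
        gcongr; exact envelope_nonneg _ _ _
    _ = envelope ν (R + 1) x := by
        unfold envelope; rw [← Real.exp_add]; ring_nf

lemma integrable_exp_neg_mul_sq_norm {d : ℕ} {b : ℝ} (hb : 0 < b) :
    Integrable (fun x : Rd d ↦ Real.exp (-b * ‖x‖ ^ 2)) := by
  have h := (GaussianFourier.integrable_cexp_neg_mul_sq_norm_add (V := Rd d) (b := (b : ℂ))
    (by simpa using hb) 0 0).norm
  refine h.congr (ae_of_all _ fun x ↦ ?_)
  simp only [zero_mul, add_zero]
  rw [Complex.norm_exp]
  norm_cast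

lemma memLp_envelope {d : ℕ} {ν : ℝ} (hν : 0 < ν) (R : ℝ) :
    MemLp (envelope (d := d) ν R) 2 volume := by
  rw [memLp_two_iff_integrable_sq_norm (continuous_envelope ν R).aestronglyMeasurable]
  refine Integrable.mono' ((integrable_exp_neg_mul_sq_norm (d := d) (half_pos hν)).const_mul
    (Real.exp (2 * R ^ 2 / ν))) ((continuous_envelope ν R).norm.pow 2).aestronglyMeasurable
    (ae_of_all _ fun x ↦ ?_)
  rw [Real.norm_of_nonneg (by positivity), Real.norm_of_nonneg (envelope_nonneg _ _ _), envelope,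
    ← Real.exp_nat_mul, ← Real.exp_add, Real.exp_le_exp]
  -- Completing the square: half of the quadratic decay of the squared envelope pays for the linear
  -- term `2R‖x‖`.
  have h : 2 * R ^ 2 / ν + -(ν / 2) * ‖x‖ ^ 2 - (2 : ℕ) * (-(ν / 2) * ‖x‖ ^ 2 + R * ‖x‖)
      = (2 * R - ν * ‖x‖) ^ 2 / (2 * ν) := by
    push_cast; field_simp; ring
  have : 0 ≤ (2 * R - ν * ‖x‖) ^ 2 / (2 * ν) := by positivity
  linarith

lemma memLp_of_norm_le_envelope {d : ℕ} {ν : ℝ} (hν : 0 < ν) {R C : ℝ} {f : Rd d → ℂ}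
    (hf : Continuous f) (h : ∀ x, ‖f x‖ ≤ C * envelope ν R x) : MemLp f 2 volume :=
  (memLp_envelope hν R).of_le_mul hf.aestronglyMeasurable
    (ae_of_all _ fun x ↦ by
      rw [Real.norm_of_nonneg (envelope_nonneg _ _ _)]; exact h x)

lemma norm_le_mul_norm_envelope {d : ℕ} {ν : ℝ} (hν : 0 < ν) {R c : ℝ} {f : L2 d}
    (h : ∀ᵐ x, ‖f x‖ ≤ c * envelope ν R x) :
    ‖f‖ ≤ c * ‖(memLp_envelope (d := d) hν R).toLp‖ := by
  refine Lp.norm_le_mul_norm_of_ae_le_mul ?_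
  filter_upwards [h, (memLp_envelope (d := d) hν R).coeFn_toLp] with x h1 h2
  rwa [h2, Real.norm_of_nonneg (envelope_nonneg _ _ _)]

/-- The (unnormalized) coherent state `exp (-ν |x|² / 2 + z · x - z · z / (4 ν))`. -/
noncomputable def coherent {d : ℕ} (ν : ℝ) (z : Fin d → ℂ) (x : Rd d) : ℂ :=
  Complex.exp (-(ν / 2) * (‖x‖ : ℂ) ^ 2 + ∑ i, z i * (x i : ℂ) - (∑ i, z i ^ 2) / (4 * ν))

/-- The polynomial `P G / G`, where `G` is the coherent state of parameter `z`. -/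
noncomputable def cohSymbol {d : ℕ} (ν : ℝ) (z : Fin d → ℂ) (x : Rd d) : ℂ :=
  ν * ∑ i, z i * (x i : ℂ) - (∑ i, z i ^ 2) / 2 + ν * d / 2

lemma continuous_coherent {d : ℕ} (ν : ℝ) (z : Fin d → ℂ) : Continuous (coherent ν z) := by
  unfold coherent; fun_prop

lemma continuous_cohSymbol {d : ℕ} (ν : ℝ) (z : Fin d → ℂ) : Continuous (cohSymbol ν z) := by
  unfold cohSymbol; fun_prop

lemma norm_pairing_le {d : ℕ} (z : Fin d → ℂ) (x : Rd d) :
    ‖∑ i, z i * (x i : ℂ)‖ ≤ (∑ i, ‖z i‖) * ‖x‖ := by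
  rw [Finset.sum_mul]
  refine (norm_sum_le _ _).trans (Finset.sum_le_sum fun i _ ↦ ?_)
  rw [norm_mul, Complex.norm_real]
  gcongr
  exact PiLp.norm_apply_le x i

lemma norm_sum_sq_le {d : ℕ} (z : Fin d → ℂ) : ‖∑ i, z i ^ 2‖ ≤ ∑ i, ‖z i‖ ^ 2 := by
  refine (norm_sum_le _ _).trans (Finset.sum_le_sum fun i _ ↦ ?_)
  rw [norm_pow]

lemma norm_coherent_le {d : ℕ} {ν : ℝ} (hν : 0 < ν) (z : Fin d → ℂ) (x : Rd d) :
    ‖coherent ν z x‖ ≤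
      Real.exp ((∑ i, ‖z i‖ ^ 2) / (4 * ν)) * envelope ν (∑ i, ‖z i‖) x := by
  rw [coherent, Complex.norm_exp, envelope, ← Real.exp_add, Real.exp_le_exp]
  have h1 := (Complex.re_le_norm _).trans (norm_pairing_le z x)
  have h2 := ((Complex.re_le_norm _).trans_eq (norm_neg _)).trans (norm_sum_sq_le z)
  have h3 : (-(∑ i, z i ^ 2) / (4 * ν)).re = (-(∑ i, z i ^ 2)).re / (4 * ν) := by
    have : (4 * (ν : ℂ)) = ((4 * ν : ℝ) : ℂ) := by push_cast; ring
    rw [this, Complex.div_ofReal_re]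
  have h4 : (-((ν : ℂ) / 2) * (‖x‖ : ℂ) ^ 2).re = -(ν / 2) * ‖x‖ ^ 2 := by
    rw [← Complex.ofReal_re (-(ν / 2) * ‖x‖ ^ 2)]; push_cast; rfl
  rw [sub_eq_add_neg, ← neg_div (4 * (ν : ℂ)) (∑ i, z i ^ 2), Complex.add_re, Complex.add_re, h3,
    h4]
  have h5 : (-(∑ i, z i ^ 2)).re / (4 * ν) ≤ (∑ i, ‖z i‖ ^ 2) / (4 * ν) := by gcongr
  linarith

lemma norm_cohSymbol_le {d : ℕ} {ν : ℝ} (hν : 0 < ν) (z : Fin d → ℂ) (x : Rd d) :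
    ‖cohSymbol ν z x‖ ≤
      (ν * (∑ i, ‖z i‖) + (∑ i, ‖z i‖ ^ 2) + ν * d) * (1 + ‖x‖) := by
  have h1 := norm_pairing_le z x
  have h2 := norm_sum_sq_le z
  have h3 : ‖cohSymbol ν z x‖ ≤ ν * ‖∑ i, z i * (x i : ℂ)‖ + ‖∑ i, z i ^ 2‖ / 2 + ν * d / 2 := by
    unfold cohSymbol
    refine (norm_add_le _ _).trans (add_le_add ((norm_sub_le _ _).trans (add_le_add ?_ ?_)) ?_)
    · rw [norm_mul, Complex.norm_real, Real.norm_of_nonneg hν.le]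
    · simp
    · simp [abs_of_pos hν]
  have h4 : 0 ≤ ∑ i, ‖z i‖ := by positivity
  have h5 : 0 ≤ ∑ i, ‖z i‖ ^ 2 := by positivity
  have h6 : 0 ≤ ν * d := by positivity
  have h7 := norm_nonneg x
  have h8 : ν * ‖∑ i, z i * (x i : ℂ)‖ ≤ ν * ((∑ i, ‖z i‖) * ‖x‖) := by gcongr
  nlinarith [mul_nonneg hν.le h4, mul_nonneg h5 h7, mul_nonneg h6 h7]

lemma memLp_coherent {d : ℕ} {ν : ℝ} (hν : 0 < ν) (z : Fin d → ℂ) :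
    MemLp (coherent ν z) 2 volume :=
  memLp_of_norm_le_envelope hν (continuous_coherent ν z) (norm_coherent_le hν z)

lemma norm_cohSymbol_mul_coherent_le {d : ℕ} {ν : ℝ} (hν : 0 < ν) (z : Fin d → ℂ) (x : Rd d) :
    ‖cohSymbol ν z x * coherent ν z x‖ ≤
      ((ν * (∑ i, ‖z i‖) + (∑ i, ‖z i‖ ^ 2) + ν * d) *
        Real.exp ((∑ i, ‖z i‖ ^ 2) / (4 * ν))) * envelope ν ((∑ i, ‖z i‖) + 1) x := by
  rw [norm_mul]
  have h := one_add_norm_mul_envelope_le ν (∑ i, ‖z i‖) x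
  calc _ ≤ (ν * (∑ i, ‖z i‖) + (∑ i, ‖z i‖ ^ 2) + ν * d) * (1 + ‖x‖) *
        (Real.exp ((∑ i, ‖z i‖ ^ 2) / (4 * ν)) * envelope ν (∑ i, ‖z i‖) x) := by
        gcongr
        · exact norm_cohSymbol_le hν z x
        · exact norm_coherent_le hν z x
    _ = (ν * (∑ i, ‖z i‖) + (∑ i, ‖z i‖ ^ 2) + ν * d) *
        Real.exp ((∑ i, ‖z i‖ ^ 2) / (4 * ν)) * ((1 + ‖x‖) * envelope ν (∑ i, ‖z i‖) x) := by ring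
    _ ≤ _ := by gcongr

lemma memLp_cohSymbol_mul_coherent {d : ℕ} {ν : ℝ} (hν : 0 < ν) (z : Fin d → ℂ) :
    MemLp (fun x ↦ cohSymbol ν z x * coherent ν z x) 2 volume :=
  memLp_of_norm_le_envelope hν ((continuous_cohSymbol ν z).mul (continuous_coherent ν z))
    (norm_cohSymbol_mul_coherent_le hν z)

/-- The coherent state as an element of `L²`. -/
noncomputable def cohLp {d : ℕ} {ν : ℝ} (hν : 0 < ν) (z : Fin d → ℂ) : L2 d :=
  (memLp_coherent hν z).toLp

/-- The image of the coherent state under the harmonic oscillator, as an element of `L²`. -/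
noncomputable def oscCohLp {d : ℕ} {ν : ℝ} (hν : 0 < ν) (z : Fin d → ℂ) : L2 d :=
  (memLp_cohSymbol_mul_coherent hν z).toLp

lemma coeFn_cohLp {d : ℕ} {ν : ℝ} (hν : 0 < ν) (z : Fin d → ℂ) :
    cohLp hν z =ᵐ[volume] coherent ν z := MemLp.coeFn_toLp _

lemma coeFn_oscCohLp {d : ℕ} {ν : ℝ} (hν : 0 < ν) (z : Fin d → ℂ) :
    oscCohLp hν z =ᵐ[volume] fun x ↦ cohSymbol ν z x * coherent ν z x := MemLp.coeFn_toLp _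

lemma conj_coherent {d : ℕ} (ν : ℝ) (z : Fin d → ℂ) (x : Rd d) :
    (starRingEnd ℂ) (coherent ν z x) = coherent ν (fun i ↦ (starRingEnd ℂ) (z i)) x := by
  simp [coherent, ← Complex.exp_conj, Complex.conj_ofNat]

lemma conj_cohSymbol {d : ℕ} (ν : ℝ) (z : Fin d → ℂ) (x : Rd d) :
    (starRingEnd ℂ) (cohSymbol ν z x) = cohSymbol ν (fun i ↦ (starRingEnd ℂ) (z i)) x := by
  simp [cohSymbol, Complex.conj_ofNat]

lemma integral_cexp_neg_mul_sq_norm_add_pairing {d : ℕ} {ν : ℝ} (hν : 0 < ν) (c : Fin d → ℂ) :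
    ∫ x : Rd d, Complex.exp (-ν * (‖x‖ : ℂ) ^ 2 + ∑ i, c i * (x i : ℂ)) =
      (Real.pi / ν) ^ (d / 2 : ℂ) * Complex.exp ((∑ i, c i ^ 2) / (4 * ν)) := by
  rw [← (PiLp.volume_preserving_toLp (Fin d)).integral_comp
    (MeasurableEquiv.toLp 2 _).measurableEmbedding]
  have h := GaussianFourier.integral_cexp_neg_mul_sum_add (b := (ν : ℂ)) (by simpa using hν) c
  rw [Fintype.card_fin] at h
  rw [← h]
  congr 1 with y
  congr 3
  rw [← Complex.ofReal_pow, EuclideanSpace.norm_sq_eq]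
  simp

lemma inner_cohLp_left {d : ℕ} {ν : ℝ} (hν : 0 < ν) (z : Fin d → ℂ) (u : L2 d) :
    inner ℂ (cohLp hν z) u = ∫ x, (starRingEnd ℂ) (coherent ν z x) * u x := by
  rw [L2.inner_def]
  refine integral_congr_ae ?_
  filter_upwards [coeFn_cohLp hν z] with x hx
  rw [hx, RCLike.inner_apply, mul_comm]

lemma inner_oscCohLp_left {d : ℕ} {ν : ℝ} (hν : 0 < ν) (z : Fin d → ℂ) (u : L2 d) :
    inner ℂ (oscCohLp hν z) u =
      ∫ x, (starRingEnd ℂ) (cohSymbol ν z x * coherent ν z x) * u x := by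
  rw [L2.inner_def]
  refine integral_congr_ae ?_
  filter_upwards [coeFn_oscCohLp hν z] with x hx
  rw [hx, RCLike.inner_apply, mul_comm]

/-- The factor `exp (-z·z / (4ν))` in `coherent` cancels the pure squares produced by the Gaussian
integral. Only the sesquilinear term survives, and it is invariant under a common phase rotation of
`z` and `w`. -/
lemma inner_cohLp_cohLp {d : ℕ} {ν : ℝ} (hν : 0 < ν) (z w : Fin d → ℂ) :
    inner ℂ (cohLp hν z) (cohLp hν w) =
      (Real.pi / ν) ^ (d / 2 : ℂ) *
        Complex.exp ((∑ i, (starRingEnd ℂ) (z i) * w i) / (2 * ν)) := by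
  have hν' : (ν : ℂ) ≠ 0 := by exact_mod_cast hν.ne'
  have h : inner ℂ (cohLp hν z) (cohLp hν w) =
      ∫ x : Rd d, Complex.exp (-ν * (‖x‖ : ℂ) ^ 2 +
        ∑ i, ((starRingEnd ℂ) (z i) + w i) * (x i : ℂ)) *
        Complex.exp (-(∑ i, ((starRingEnd ℂ) (z i)) ^ 2 + ∑ i, w i ^ 2) / (4 * ν)) := by
    rw [inner_cohLp_left]
    refine integral_congr_ae ?_
    filter_upwards [coeFn_cohLp hν w] with x hx
    rw [hx, conj_coherent, coherent, coherent, ← Complex.exp_add, ← Complex.exp_add]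
    congr 1
    simp only [add_mul, Finset.sum_add_distrib]
    ring
  rw [h, integral_mul_const, integral_cexp_neg_mul_sq_norm_add_pairing hν, mul_assoc,
    ← Complex.exp_add]
  congr 2
  simp only [add_sq, Finset.sum_add_distrib]
  have : ∑ i, 2 * (starRingEnd ℂ) (z i) * w i = 2 * ∑ i, (starRingEnd ℂ) (z i) * w i := by
    rw [Finset.mul_sum]; simp only [mul_assoc]
  rw [this]
  field_simp
  ring

/-! ### Density of the coherent states -/

-- Every test function is the Fourier transform of a Schwartz function, so moving the transform onto
-- `f` shows that `f` integrates to zero against all test functions.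
open scoped FourierTransform SchwartzMap in
lemma ae_eq_zero_of_fourier_eq_zero {d : ℕ} {f : Rd d → ℂ} (hf : Integrable f)
    (h : ∀ ξ, 𝓕 f ξ = 0) : ∀ᵐ x, f x = 0 := by
  refine ae_eq_zero_of_integral_contDiff_smul_eq_zero hf.locallyIntegrable fun g hg hgs ↦ ?_
  have hgc : HasCompactSupport (fun x ↦ (g x : ℂ)) := hgs.comp_left Complex.ofReal_zero
  let φ : 𝓢(Rd d, ℂ) := hgc.toSchwartzMap (Complex.ofRealCLM.contDiff.comp hg)
  let ψ : 𝓢(Rd d, ℂ) := 𝓕⁻ φ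
  have key : ∫ ξ, 𝓕 f ξ • ψ ξ = ∫ x, f x • 𝓕 (ψ : Rd d → ℂ) x := by
    simpa using! (VectorFourier.integral_fourierIntegral_smul_eq_flip (L := innerₗ (Rd d))
      Real.continuous_fourierChar continuous_inner hf ψ.integrable)
  have h2 : 𝓕 (ψ : Rd d → ℂ) = φ := by
    rw [← SchwartzMap.fourier_coe, FourierTransform.fourier_fourierInv_eq]
  rw [h2] at key
  simp only [h, zero_smul, integral_zero] at key
  rw [key]
  refine integral_congr_ae (ae_of_all _ fun x ↦ ?_)
  change g x • f x = f x • (g x : ℂ)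
  rw [Complex.real_smul, smul_eq_mul, mul_comm]

/-- Purely imaginary parameters already suffice: the corresponding inner products are, up to nonzero
factors, the values of the Fourier transform of a Gaussian times `u`, and the Gaussian never
vanishes. -/
lemma eq_zero_of_forall_inner_cohLp_eq_zero {d : ℕ} {ν : ℝ} (hν : 0 < ν) (u : L2 d)
    (h : ∀ z, inner ℂ (cohLp hν z) u = 0) : u = 0 := by
  have hInt : Integrable (fun x : Rd d ↦ coherent ν 0 x * u x) :=
    (memLp_coherent hν 0).integrable_mul (Lp.memLp u)
  have h0 : ∀ᵐ x : Rd d, coherent ν 0 x * u x = 0 := by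
    refine ae_eq_zero_of_fourier_eq_zero hInt fun ξ ↦ ?_
    rw [Real.fourier_eq']
    set z : Fin d → ℂ := fun i ↦ 2 * Real.pi * Complex.I * (ξ i : ℂ) with hz
    have h1 := h z
    rw [inner_cohLp_left] at h1
    have h2 : ∀ x : Rd d, Complex.exp (↑(-2 * Real.pi * inner ℝ x ξ) * Complex.I) •
        (coherent ν 0 x * u x) =
        Complex.exp ((∑ i, ((starRingEnd ℂ) (z i)) ^ 2) / (4 * ν)) *
          ((starRingEnd ℂ) (coherent ν z x) * u x) := by
      intro x
      rw [conj_coherent, smul_eq_mul, ← mul_assoc, ← mul_assoc, coherent, coherent,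
        ← Complex.exp_add, ← Complex.exp_add]
      congr 2
      have : ((inner ℝ x ξ : ℝ) : ℂ) = ∑ i, (x i : ℂ) * ξ i := by
        rw [PiLp.inner_apply]; push_cast
        exact Finset.sum_congr rfl fun i _ ↦ by simp [mul_comm]
      push_cast
      rw [this]
      have h3 : ∑ i, (starRingEnd ℂ) (z i) * (x i : ℂ) =
          (-2 * Real.pi * ∑ i, (x i : ℂ) * ξ i) * Complex.I := by
        rw [Finset.mul_sum, Finset.sum_mul]
        refine Finset.sum_congr rfl fun i _ ↦ ?_
        simp only [hz, map_mul, Complex.conj_I, Complex.conj_ofReal, map_ofNat]; ring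
      rw [h3]
      simp
      ring
    simp_rw [h2]
    rw [integral_const_mul, h1, mul_zero]
  rw [Lp.eq_zero_iff_ae_eq_zero]
  filter_upwards [h0] with x hx
  exact (mul_eq_zero.1 hx).resolve_left (Complex.exp_ne_zero _)

/-! ### Time evolution of coherent states -/

/-- Rotation of the phase-space parameter by the classical flow. -/
noncomputable def rotate {d : ℕ} (ν t : ℝ) (z : Fin d → ℂ) : Fin d → ℂ :=
  fun i ↦ Complex.exp (-(ν * t) * Complex.I) * z i

/-- The zero-point phase `exp (-i ν d t / 2)`. -/
noncomputable def groundPhase (d : ℕ) (ν t : ℝ) : ℂ :=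
  Complex.exp (-(ν * d * t / 2) * Complex.I)

lemma norm_exp_neg_mul_I (ν t : ℝ) : ‖Complex.exp (-(ν * t) * Complex.I)‖ = 1 := by
  have := Complex.norm_exp_ofReal_mul_I (-(ν * t))
  push_cast at this
  exact this

lemma norm_groundPhase (d : ℕ) (ν t : ℝ) : ‖groundPhase d ν t‖ = 1 := by
  have := Complex.norm_exp_ofReal_mul_I (-(ν * d * t / 2))
  push_cast at this
  exact this

lemma norm_rotate_apply {d : ℕ} (ν t : ℝ) (z : Fin d → ℂ) (i : Fin d) :
    ‖rotate ν t z i‖ = ‖z i‖ := by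
  rw [rotate, norm_mul, norm_exp_neg_mul_I, one_mul]

lemma rotate_zero {d : ℕ} (ν : ℝ) (z : Fin d → ℂ) : rotate ν 0 z = z := by
  ext i; simp [rotate]

lemma rotate_rotate {d : ℕ} (ν s t : ℝ) (z : Fin d → ℂ) :
    rotate ν s (rotate ν t z) = rotate ν (s + t) z := by
  ext i
  simp only [rotate]
  rw [← mul_assoc, ← Complex.exp_add]
  push_cast; ring_nf

lemma groundPhase_zero (d : ℕ) (ν : ℝ) : groundPhase d ν 0 = 1 := by simp [groundPhase]

lemma groundPhase_add (d : ℕ) (ν s t : ℝ) :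
    groundPhase d ν (s + t) = groundPhase d ν s * groundPhase d ν t := by
  simp only [groundPhase]
  rw [← Complex.exp_add]
  push_cast; ring_nf

/-- The mean value inequality is applied twice; the sharp Taylor factor `1/2` is not needed. -/
lemma norm_sub_sub_smul_le_of_norm_deriv_deriv_le {E : Type*} [NormedAddCommGroup E]
    [NormedSpace ℝ E] {g g' g'' : ℝ → E} {M : ℝ}
    (h1 : ∀ s, HasDerivAt g (g' s) s) (h2 : ∀ s, HasDerivAt g' (g'' s) s)
    (hM : ∀ s, ‖g'' s‖ ≤ M) (s t : ℝ) : ‖g s - g t - (s - t) • g' t‖ ≤ M * (s - t) ^ 2 := by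
  have hb : ∀ r, ‖g' r - g' t‖ ≤ M * ‖r - t‖ := fun r ↦
    Convex.norm_image_sub_le_of_norm_hasDerivWithin_le (s := univ)
      (fun x _ ↦ (h2 x).hasDerivWithinAt) (fun x _ ↦ hM x) convex_univ (mem_univ t) (mem_univ r)
  have hM0 : 0 ≤ M := (norm_nonneg _).trans (hM t)
  have h3 := Convex.norm_image_sub_le_of_norm_hasDerivWithin_le (s := uIcc t s)
    (f := fun r ↦ g r - r • g' t) (f' := fun r ↦ g' r - g' t) (C := M * ‖s - t‖)
    (fun x _ ↦ by
      simpa using! ((h1 x).sub ((hasDerivAt_id x).smul_const (g' t))).hasDerivWithinAt)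
    (fun x hx ↦ (hb x).trans (by
      gcongr
      simpa [Real.norm_eq_abs] using abs_sub_left_of_mem_uIcc hx))
    (convex_uIcc t s) left_mem_uIcc right_mem_uIcc
  have h4 : g s - g t - (s - t) • g' t = g s - s • g' t - (g t - t • g' t) := by
    rw [sub_smul]; abel
  rw [h4]
  refine h3.trans_eq ?_
  rw [Real.norm_eq_abs, mul_assoc, ← sq, sq_abs]

/-- A family of `L²` functions which is twice differentiable pointwise, with second derivative
dominated by a Gaussian envelope, is differentiable in `L²`. -/
lemma hasDerivAt_Lp_of_envelope {d : ℕ} {ν : ℝ} (hν : 0 < ν) {R C : ℝ} {u v : ℝ → L2 d}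
    {g g' g'' : ℝ → Rd d → ℂ} (hu : ∀ t, u t =ᵐ[volume] g t) (hv : ∀ t, v t =ᵐ[volume] g' t)
    (h1 : ∀ x s, HasDerivAt (fun t ↦ g t x) (g' s x) s)
    (h2 : ∀ x s, HasDerivAt (fun t ↦ g' t x) (g'' s x) s)
    (hC : ∀ x s, ‖g'' s x‖ ≤ C * envelope ν R x) (t : ℝ) : HasDerivAt u (v t) t := by
  rw [hasDerivAt_iff_isLittleO]
  have hb : ∀ s, ‖u s - u t - (s - t) • v t‖ ≤
      C * (s - t) ^ 2 * ‖(memLp_envelope (d := d) hν R).toLp‖ := by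
    intro s
    refine norm_le_mul_norm_envelope hν ?_
    filter_upwards [hu s, hu t, hv t, Lp.coeFn_sub (u s) (u t),
      Lp.coeFn_sub (u s - u t) ((s - t) • v t), Lp.coeFn_smul (s - t) (v t)]
      with x e1 e2 e3 e4 e5 e6
    rw [e5, Pi.sub_apply, e4, e6, Pi.sub_apply, Pi.smul_apply, e1, e2, e3]
    refine (norm_sub_sub_smul_le_of_norm_deriv_deriv_le (h1 x) (h2 x) (hC x) s t).trans_eq ?_
    ring
  refine Asymptotics.IsBigO.trans_isLittleO (g := fun s ↦ (s - t) ^ 2)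
    (Asymptotics.IsBigO.of_bound (C * ‖(memLp_envelope (d := d) hν R).toLp‖)
      (Eventually.of_forall fun s ↦ (hb s).trans_eq ?_)) ?_
  · rw [Real.norm_of_nonneg (sq_nonneg _)]; ring
  · have h := Asymptotics.isLittleO_pow_id (𝕜 := ℝ) (n := 2) (by norm_num)
    have ht : Tendsto (fun s ↦ s - t) (𝓝 t) (𝓝 0) := by
      have := (continuous_id.sub continuous_const : Continuous fun s : ℝ ↦ s - t).tendsto t
      simpa using! this
    exact h.comp_tendsto ht

lemma hasDerivAt_exp_neg_mul_I (ν t : ℝ) :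
    HasDerivAt (fun t : ℝ ↦ Complex.exp (-(ν * t) * Complex.I))
      (-(ν * Complex.I) * Complex.exp (-(ν * t) * Complex.I)) t := by
  have h : HasDerivAt (fun t : ℝ ↦ -((ν : ℂ) * t) * Complex.I) (-(ν * 1) * Complex.I) t :=
    (((Complex.ofRealCLM.hasDerivAt (x := t)).const_mul (ν : ℂ)).neg).mul_const _
  convert h.cexp using 1
  ring

lemma pairing_rotate {d : ℕ} (ν t : ℝ) (z : Fin d → ℂ) (x : Rd d) :
    ∑ i, rotate ν t z i * (x i : ℂ) =
      Complex.exp (-(ν * t) * Complex.I) * ∑ i, z i * (x i : ℂ) := by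
  simp only [rotate, Finset.mul_sum, mul_assoc]

lemma sum_sq_rotate {d : ℕ} (ν t : ℝ) (z : Fin d → ℂ) :
    ∑ i, rotate ν t z i ^ 2 =
      Complex.exp (-(ν * t) * Complex.I) ^ 2 * ∑ i, z i ^ 2 := by
  simp only [rotate, Finset.mul_sum, mul_pow]

/-- Pointwise Schrödinger equation: the zero-point phase accounts for the constant `νd/2` in
`cohSymbol`, and the rotation of the parameter for everything else. -/
lemma hasDerivAt_groundPhase_mul_coherent {d : ℕ} {ν : ℝ} (hν : 0 < ν) (z : Fin d → ℂ)
    (x : Rd d) (t : ℝ) :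
    HasDerivAt (fun t ↦ groundPhase d ν t * coherent ν (rotate ν t z) x)
      (-Complex.I * (groundPhase d ν t * (cohSymbol ν (rotate ν t z) x *
        coherent ν (rotate ν t z) x))) t := by
  have hν' : (ν : ℂ) ≠ 0 := by exact_mod_cast hν.ne'
  simp only [groundPhase, coherent, cohSymbol, pairing_rotate, sum_sq_rotate]
  have he := hasDerivAt_exp_neg_mul_I ν t
  have hp : HasDerivAt (fun t : ℝ ↦ -((ν : ℂ) * d * t / 2) * Complex.I)
      (-((ν : ℂ) * d * 1 / 2) * Complex.I) t :=
    ((((Complex.ofRealCLM.hasDerivAt (x := t)).const_mul ((ν : ℂ) * d)).div_const 2).neg).mul_const _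
  have hq := ((he.mul_const (∑ i, z i * (x i : ℂ))).const_add
    (-((ν : ℂ) / 2) * (‖x‖ : ℂ) ^ 2)).sub (((he.pow 2).mul_const (∑ i, z i ^ 2)).div_const (4 * (ν : ℂ)))
  refine (hp.cexp.mul hq.cexp).congr_deriv ?_
  simp only [Pi.sub_apply, Pi.pow_apply, Nat.add_one_sub_one, pow_one]
  push_cast
  field_simp
  ring

/-- The derivative of `t ↦ cohSymbol ν (rotate ν t z) x`. -/
noncomputable def cohSymbolDeriv {d : ℕ} (ν : ℝ) (z : Fin d → ℂ) (x : Rd d) : ℂ :=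
  -(ν * Complex.I) * (ν * ∑ i, z i * (x i : ℂ) - ∑ i, z i ^ 2)

lemma hasDerivAt_cohSymbol_rotate {d : ℕ} (ν : ℝ) (z : Fin d → ℂ) (x : Rd d) (t : ℝ) :
    HasDerivAt (fun t ↦ cohSymbol ν (rotate ν t z) x)
      (cohSymbolDeriv ν (rotate ν t z) x) t := by
  simp only [cohSymbol, cohSymbolDeriv, pairing_rotate, sum_sq_rotate]
  have he := hasDerivAt_exp_neg_mul_I ν t
  have hq := (((he.mul_const (∑ i, z i * (x i : ℂ))).const_mul (ν : ℂ)).sub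
    (((he.pow 2).mul_const (∑ i, z i ^ 2)).div_const 2)).add_const ((ν : ℂ) * d / 2)
  refine hq.congr_deriv ?_
  push_cast
  ring

lemma norm_cohSymbolDeriv_le {d : ℕ} {ν : ℝ} (hν : 0 < ν) (z : Fin d → ℂ) (x : Rd d) :
    ‖cohSymbolDeriv ν z x‖ ≤ (ν * (ν * (∑ i, ‖z i‖) + (∑ i, ‖z i‖ ^ 2))) * (1 + ‖x‖) := by
  have h1 := norm_pairing_le z x
  have h2 := norm_sum_sq_le z
  have h3 : ‖cohSymbolDeriv ν z x‖ ≤ ν * (ν * ‖∑ i, z i * (x i : ℂ)‖ + ‖∑ i, z i ^ 2‖) := by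
    unfold cohSymbolDeriv
    rw [norm_mul, norm_neg, norm_mul, Complex.norm_I, mul_one, Complex.norm_real,
      Real.norm_of_nonneg hν.le]
    gcongr
    refine (norm_sub_le _ _).trans ?_
    rw [norm_mul, Complex.norm_real, Real.norm_of_nonneg hν.le]
  have h4 : 0 ≤ ∑ i, ‖z i‖ := by positivity
  have h5 : 0 ≤ ∑ i, ‖z i‖ ^ 2 := by positivity
  have h7 := norm_nonneg x
  refine h3.trans ?_
  rw [mul_assoc]
  gcongr
  have h8 : ν * ‖∑ i, z i * (x i : ℂ)‖ ≤ ν * ((∑ i, ‖z i‖) * ‖x‖) := by gcongr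
  nlinarith [mul_nonneg hν.le h4, mul_nonneg h5 h7]

/-- The second time derivative is a polynomial of degree two in `‖x‖` times a coherent state, with
bounds uniform in time since rotation preserves `‖z i‖`. An envelope with `R` raised by two
therefore dominates it. -/
lemma hasDerivAt_groundPhase_smul_cohLp {d : ℕ} {ν : ℝ} (hν : 0 < ν) (z : Fin d → ℂ) (t : ℝ) :
    HasDerivAt (fun t ↦ groundPhase d ν t • cohLp hν (rotate ν t z))
      ((-Complex.I) • groundPhase d ν t • oscCohLp hν (rotate ν t z)) t := by
  set N := ∑ i, ‖z i‖ with hN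
  set Q := ∑ i, ‖z i‖ ^ 2 with hQ
  have hN0 : 0 ≤ N := by positivity
  have hQ0 : 0 ≤ Q := by positivity
  set K := ν * N + Q + ν * d with hK
  have hK0 : 0 ≤ K := by positivity
  set K' := ν * (ν * N + Q) with hK'
  have hK'0 : 0 ≤ K' := by positivity
  refine hasDerivAt_Lp_of_envelope hν (R := N + 1 + 1) (C := (K ^ 2 + K') * Real.exp (Q / (4 * ν)))
    (v := fun t ↦ (-Complex.I) • groundPhase d ν t • oscCohLp hν (rotate ν t z))
    (g := fun t x ↦ groundPhase d ν t * coherent ν (rotate ν t z) x)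
    (g' := fun t x ↦ -Complex.I * (groundPhase d ν t * (cohSymbol ν (rotate ν t z) x *
        coherent ν (rotate ν t z) x)))
    (g'' := fun t x ↦ -Complex.I * (cohSymbolDeriv ν (rotate ν t z) x *
      (groundPhase d ν t * coherent ν (rotate ν t z) x) + cohSymbol ν (rotate ν t z) x *
        (-Complex.I * (groundPhase d ν t * (cohSymbol ν (rotate ν t z) x *
        coherent ν (rotate ν t z) x)))))
    (fun t ↦ ?_) (fun t ↦ ?_) (fun x s ↦ hasDerivAt_groundPhase_mul_coherent hν z x s)
    (fun x s ↦ ?_) (fun x s ↦ ?_) t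
  · filter_upwards [Lp.coeFn_smul (groundPhase d ν t) (cohLp hν (rotate ν t z)),
      coeFn_cohLp hν (rotate ν t z)] with x e1 e2
    rw [e1, Pi.smul_apply, e2, smul_eq_mul]
  · filter_upwards [Lp.coeFn_smul (groundPhase d ν t) (oscCohLp hν (rotate ν t z)),
      Lp.coeFn_smul (-Complex.I) (groundPhase d ν t • oscCohLp hν (rotate ν t z)),
      coeFn_oscCohLp hν (rotate ν t z)] with x e1 e2 e3
    rw [e2, Pi.smul_apply, e1, Pi.smul_apply, e3, smul_eq_mul, smul_eq_mul]
  · refine HasDerivAt.const_mul _ ?_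
    have := (hasDerivAt_cohSymbol_rotate ν z x s).mul
      (hasDerivAt_groundPhase_mul_coherent hν z x s)
    refine this.congr_of_eventuallyEq (Eventually.of_forall fun r ↦ ?_)
    simp only [Pi.mul_apply]
    ring
  · have a1 : ‖cohSymbol ν (rotate ν s z) x‖ ≤ K * (1 + ‖x‖) := by
      simpa only [norm_rotate_apply] using norm_cohSymbol_le hν (rotate ν s z) x
    have a2 : ‖cohSymbolDeriv ν (rotate ν s z) x‖ ≤ K' * (1 + ‖x‖) := by
      simpa only [norm_rotate_apply] using norm_cohSymbolDeriv_le hν (rotate ν s z) x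
    have a3 : ‖coherent ν (rotate ν s z) x‖ ≤ Real.exp (Q / (4 * ν)) * envelope ν N x := by
      simpa only [norm_rotate_apply] using norm_coherent_le hν (rotate ν s z) x
    have a4 := one_add_norm_mul_envelope_le ν N x
    have a5 := one_add_norm_mul_envelope_le ν (N + 1) x
    have hx := norm_nonneg x
    have e0 := envelope_nonneg ν N x
    rw [norm_mul, norm_neg, Complex.norm_I, one_mul]
    refine (norm_add_le _ _).trans ?_
    simp only [norm_mul, norm_neg, Complex.norm_I, one_mul, norm_groundPhase]
    set E := Real.exp (Q / (4 * ν))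
    have hE : 0 ≤ E := (Real.exp_pos _).le
    calc _ ≤ K' * (1 + ‖x‖) * (E * envelope ν N x) +
          K * (1 + ‖x‖) * (K * (1 + ‖x‖) * (E * envelope ν N x)) := by gcongr
      -- The degree-one term is given a spare factor so that both terms have degree two.
      _ ≤ K' * (1 + ‖x‖) * (E * envelope ν N x) * (1 + ‖x‖) +
          K * (1 + ‖x‖) * (K * (1 + ‖x‖) * (E * envelope ν N x)) := by
          refine add_le_add (le_mul_of_one_le_right (by positivity) (by linarith)) le_rfl
      _ = (K ^ 2 + K') * E * ((1 + ‖x‖) * ((1 + ‖x‖) * envelope ν N x)) := by ring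
      _ ≤ (K ^ 2 + K') * E * ((1 + ‖x‖) * envelope ν (N + 1) x) := by gcongr
      _ ≤ _ := by gcongr

/-! ### Partial derivatives and the Laplacian -/

/-- The `i`-th partial derivative. -/
noncomputable def pd {d : ℕ} (i : Fin d) (f : Rd d → ℂ) (x : Rd d) : ℂ :=
  fderiv ℝ f x (EuclideanSpace.single i 1)

lemma ContDiff.pd {d : ℕ} {f : Rd d → ℂ} (hf : ContDiff ℝ ((⊤ : ℕ∞) : WithTop ℕ∞) f) (i : Fin d) :
    ContDiff ℝ ((⊤ : ℕ∞) : WithTop ℕ∞) (pd i f) :=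
  (hf.fderiv_right (m := ((⊤ : ℕ∞) : WithTop ℕ∞)) (by simp)).clm_apply contDiff_const

lemma HasCompactSupport.pd {d : ℕ} {f : Rd d → ℂ} (hf : HasCompactSupport f) (i : Fin d) :
    HasCompactSupport (pd i f) :=
  hf.fderiv_apply ℝ _

lemma laplacian_eq_sum_pd {d : ℕ} {f : Rd d → ℂ} (hf : ContDiff ℝ ((⊤ : ℕ∞) : WithTop ℕ∞) f)
    (x : Rd d) : (Δ f) x = ∑ i, pd i (pd i f) x := by
  rw [InnerProductSpace.laplacian_eq_iteratedFDeriv_orthonormalBasis f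
    (EuclideanSpace.basisFun (Fin d) ℝ)]
  refine Finset.sum_congr rfl fun i _ ↦ ?_
  rw [iteratedFDeriv_two_apply]
  simp only [Matrix.cons_val_zero, Matrix.cons_val_one, EuclideanSpace.basisFun_apply]
  have hd : DifferentiableAt ℝ (fderiv ℝ f) x :=
    (hf.fderiv_right (m := ((⊤ : ℕ∞) : WithTop ℕ∞)) (by simp)).differentiable (by simp) x
  change _ = fderiv ℝ (fun y ↦ fderiv ℝ f y (EuclideanSpace.single i 1)) x _
  rw [fderiv_clm_apply hd (differentiableAt_const _)]
  simp

lemma pd_mul {d : ℕ} {f g : Rd d → ℂ} {x : Rd d} (hf : DifferentiableAt ℝ f x)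
    (hg : DifferentiableAt ℝ g x) (i : Fin d) :
    pd i (fun y ↦ f y * g y) x = f x * pd i g x + pd i f x * g x := by
  unfold pd
  rw [fderiv_fun_mul hf hg]
  simp [mul_comm]

lemma pd_add {d : ℕ} {f g : Rd d → ℂ} {x : Rd d} (hf : DifferentiableAt ℝ f x)
    (hg : DifferentiableAt ℝ g x) (i : Fin d) :
    pd i (fun y ↦ f y + g y) x = pd i f x + pd i g x := by
  unfold pd
  rw [fderiv_fun_add hf hg]
  simp

lemma laplacian_mul {d : ℕ} {f g : Rd d → ℂ} (hf : ContDiff ℝ ((⊤ : ℕ∞) : WithTop ℕ∞) f)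
    (hg : ContDiff ℝ ((⊤ : ℕ∞) : WithTop ℕ∞) g) (x : Rd d) :
    (Δ (fun y ↦ f y * g y)) x =
      f x * (Δ g) x + 2 * ∑ i, pd i f x * pd i g x + (Δ f) x * g x := by
  have df := hf.differentiable (by simp)
  have dg := hg.differentiable (by simp)
  rw [laplacian_eq_sum_pd (hf.mul hg), laplacian_eq_sum_pd hf, laplacian_eq_sum_pd hg,
    Finset.mul_sum, Finset.mul_sum, Finset.sum_mul, ← Finset.sum_add_distrib,
    ← Finset.sum_add_distrib]
  refine Finset.sum_congr rfl fun i _ ↦ ?_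
  have h1 : pd i (fun y ↦ f y * g y) = fun y ↦ f y * pd i g y + pd i f y * g y :=
    funext fun y ↦ pd_mul (df y) (dg y) i
  have dpf := (hf.pd i).differentiable (by simp)
  have dpg := (hg.pd i).differentiable (by simp)
  rw [h1, pd_add ((df x).fun_mul (dpg x)) ((dpf x).fun_mul (dg x)), pd_mul (df x) (dpg x),
    pd_mul (dpf x) (dg x)]
  ring

lemma pd_comp_smul {d : ℕ} (f : Rd d → ℂ) (a : ℝ) (i : Fin d) (x : Rd d) :
    pd i (fun y ↦ f (a • y)) x = a * pd i f (a • x) := by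
  unfold pd
  rw [fderiv_comp_smul]
  simp

lemma pd_const_mul {d : ℕ} {f : Rd d → ℂ} {x : Rd d} (c : ℂ) (hf : DifferentiableAt ℝ f x)
    (i : Fin d) : pd i (fun y ↦ c * f y) x = c * pd i f x := by
  unfold pd
  rw [fderiv_const_mul hf]
  simp

lemma laplacian_comp_smul {d : ℕ} {f : Rd d → ℂ} (hf : ContDiff ℝ ((⊤ : ℕ∞) : WithTop ℕ∞) f)
    (a : ℝ) (x : Rd d) : (Δ (fun y ↦ f (a • y))) x = (a : ℂ) ^ 2 * (Δ f) (a • x) := by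
  have hfa : ContDiff ℝ ((⊤ : ℕ∞) : WithTop ℕ∞) fun y ↦ f (a • y) :=
    hf.comp (contDiff_const_smul a)
  rw [laplacian_eq_sum_pd hf, laplacian_eq_sum_pd hfa, Finset.mul_sum]
  refine Finset.sum_congr rfl fun i _ ↦ ?_
  have h : pd i (fun y ↦ f (a • y)) = fun y ↦ (a : ℂ) * pd i f (a • y) :=
    funext fun y ↦ pd_comp_smul f a i y
  have hpa : ContDiff ℝ ((⊤ : ℕ∞) : WithTop ℕ∞) fun y ↦ pd i f (a • y) :=
    (hf.pd i).comp (contDiff_const_smul a)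
  rw [h, pd_const_mul _ (hpa.differentiable (by simp) x),
    pd_comp_smul]
  ring

lemma integral_mul_pd_eq_neg {d : ℕ} {f g : Rd d → ℂ}
    (hf : ContDiff ℝ ((⊤ : ℕ∞) : WithTop ℕ∞) f) (hg : ContDiff ℝ ((⊤ : ℕ∞) : WithTop ℕ∞) g)
    (hc : HasCompactSupport g) (i : Fin d) :
    ∫ x, f x * pd i g x = -∫ x, pd i f x * g x := by
  refine integral_mul_fderiv_eq_neg_fderiv_mul_of_integrable ?_ ?_ ?_
    (fun x _ ↦ hf.differentiable (by simp) x) (fun x _ ↦ hg.differentiable (by simp) x)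
  · exact ((hf.pd i).continuous.mul hg.continuous).integrable_of_hasCompactSupport hc.mul_left
  · exact (hf.continuous.mul (hg.pd i).continuous).integrable_of_hasCompactSupport
      (hc.pd i).mul_left
  · exact (hf.continuous.mul hg.continuous).integrable_of_hasCompactSupport hc.mul_left

/-- Two integrations by parts. Compact support of one factor is enough, so a coherent state can be
paired with a test function without any cutoff. -/
lemma integral_mul_laplacian {d : ℕ} {f g : Rd d → ℂ}
    (hf : ContDiff ℝ ((⊤ : ℕ∞) : WithTop ℕ∞) f) (hg : ContDiff ℝ ((⊤ : ℕ∞) : WithTop ℕ∞) g)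
    (hc : HasCompactSupport g) : ∫ x, f x * (Δ g) x = ∫ x, (Δ f) x * g x := by
  simp_rw [laplacian_eq_sum_pd hf, laplacian_eq_sum_pd hg, Finset.mul_sum, Finset.sum_mul]
  rw [integral_finsetSum, integral_finsetSum]
  · refine Finset.sum_congr rfl fun i _ ↦ ?_
    have h := integral_mul_pd_eq_neg (hf.pd i) hg hc i
    rw [integral_mul_pd_eq_neg hf (hg.pd i) (hc.pd i) i, h, neg_neg]
  · intro i _
    exact (((hf.pd i).pd i).continuous.mul hg.continuous).integrable_of_hasCompactSupport
      hc.mul_left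
  · intro i _
    exact (hf.continuous.mul ((hg.pd i).pd i).continuous).integrable_of_hasCompactSupport
      ((hc.pd i).pd i).mul_left

lemma continuous_laplacian {d : ℕ} {f : Rd d → ℂ} (hf : ContDiff ℝ ((⊤ : ℕ∞) : WithTop ℕ∞) f) :
    Continuous (Δ f) := by
  have h : (Δ f) = fun x ↦ ∑ i, pd i (pd i f) x := funext fun x ↦ laplacian_eq_sum_pd hf x
  rw [h]
  exact continuous_finsetSum _ fun i _ ↦ ((hf.pd i).pd i).continuous

lemma continuous_oscillatorExpr {d : ℕ} (ν : ℝ) {φ : Rd d → ℂ}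
    (hφ : ContDiff ℝ ((⊤ : ℕ∞) : WithTop ℕ∞) φ) : Continuous (oscillatorExpr ν φ) := by
  have h1 := continuous_laplacian hφ
  have h2 := hφ.continuous
  unfold oscillatorExpr
  fun_prop

lemma hasCompactSupport_laplacian {d : ℕ} {φ : Rd d → ℂ}
    (hφ : ContDiff ℝ ((⊤ : ℕ∞) : WithTop ℕ∞) φ) (hc : HasCompactSupport φ) :
    HasCompactSupport (Δ φ) := by
  refine hc.mono' fun x hx ↦ ?_
  by_contra h
  apply hx
  rw [laplacian_eq_sum_pd hφ]
  refine Finset.sum_eq_zero fun i _ ↦ ?_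
  have h1 : tsupport (pd i (pd i φ)) ⊆ tsupport φ :=
    (tsupport_fderiv_apply_subset ℝ _).trans (tsupport_fderiv_apply_subset ℝ _)
  exact image_eq_zero_of_notMem_tsupport fun h2 ↦ h (h1 h2)

lemma hasCompactSupport_oscillatorExpr {d : ℕ} (ν : ℝ) {φ : Rd d → ℂ}
    (hφ : ContDiff ℝ ((⊤ : ℕ∞) : WithTop ℕ∞) φ) (hc : HasCompactSupport φ) :
    HasCompactSupport (oscillatorExpr ν φ) := by
  have h1 : HasCompactSupport fun x : Rd d ↦ (ν : ℂ) ^ 2 * (‖x‖ : ℂ) ^ 2 * φ x := hc.mul_left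
  exact (h1.sub (hasCompactSupport_laplacian hφ hc)).mul_left

/-! ### The oscillator on coherent states -/

lemma contDiff_coherent {d : ℕ} (ν : ℝ) (z : Fin d → ℂ) :
    ContDiff ℝ ((⊤ : ℕ∞) : WithTop ℕ∞) (coherent ν z) := by
  have h1 : ContDiff ℝ ((⊤ : ℕ∞) : WithTop ℕ∞) (fun x : Rd d ↦ (‖x‖ : ℂ) ^ 2) := by
    have : (fun x : Rd d ↦ (‖x‖ : ℂ) ^ 2) = fun x ↦ Complex.ofRealCLM (‖x‖ ^ 2) := by
      ext x; simp
    rw [this]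
    exact Complex.ofRealCLM.contDiff.comp (contDiff_norm_sq ℝ)
  have h2 : ∀ i, ContDiff ℝ ((⊤ : ℕ∞) : WithTop ℕ∞) (fun x : Rd d ↦ (x i : ℂ)) := fun i ↦
    Complex.ofRealCLM.contDiff.comp (contDiff_euclidean.1 contDiff_id i)
  unfold coherent
  exact (((contDiff_const.mul h1).add (ContDiff.sum fun i _ ↦ contDiff_const.mul (h2 i))).sub
    contDiff_const).cexp

lemma hasFDerivAt_coord {d : ℕ} (i : Fin d) (x : Rd d) :
    HasFDerivAt (fun x : Rd d ↦ (x i : ℂ))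
      (Complex.ofRealCLM ∘L EuclideanSpace.proj i) x :=
  (Complex.ofRealCLM ∘L EuclideanSpace.proj (𝕜 := ℝ) i).hasFDerivAt

lemma pd_coherent {d : ℕ} (ν : ℝ) (z : Fin d → ℂ) (i : Fin d) :
    pd i (coherent ν z) = fun x ↦ (z i - ν * (x i : ℂ)) * coherent ν z x := by
  ext x
  have h1 : HasFDerivAt (fun x : Rd d ↦ -((ν : ℂ) / 2) * (‖x‖ : ℂ) ^ 2)
      ((-((ν : ℂ) / 2)) • (Complex.ofRealCLM ∘L (2 • (innerSL ℝ) x))) x := by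
    have : HasFDerivAt (fun x : Rd d ↦ (‖x‖ : ℂ) ^ 2)
        (Complex.ofRealCLM ∘L (2 • (innerSL ℝ) x)) x := by
      have h := Complex.ofRealCLM.hasFDerivAt.comp x (hasStrictFDerivAt_norm_sq x).hasFDerivAt
      refine h.congr_of_eventuallyEq (Eventually.of_forall fun y ↦ ?_)
      simp
    exact this.const_mul _
  have h2 : HasFDerivAt (fun x : Rd d ↦ ∑ j, z j * (x j : ℂ))
      (∑ j, z j • (Complex.ofRealCLM ∘L EuclideanSpace.proj (𝕜 := ℝ) j)) x :=
    HasFDerivAt.fun_sum fun j _ ↦ (hasFDerivAt_coord j x).const_mul (z j)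
  have h3 := ((h1.add h2).sub_const ((∑ i, z i ^ 2) / (4 * (ν : ℂ)))).cexp
  unfold pd
  have h4 : fderiv ℝ (coherent ν z) x = _ := h3.fderiv
  rw [h4]
  simp only [_root_.smul_apply, _root_.add_apply, _root_.sum_apply, ContinuousLinearMap.comp_apply, Complex.ofRealCLM_apply,
    innerSL_apply_apply, smul_eq_mul]
  have h5 : ∑ j, z j * ((EuclideanSpace.proj (𝕜 := ℝ) j (EuclideanSpace.single i (1 : ℝ)) : ℝ) : ℂ)
      = z i := by
    rw [Finset.sum_eq_single i]
    · simp
    · intro b _ hb; simp [hb]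
    · simp
  rw [h5, EuclideanSpace.inner_single_right]
  simp only [coherent, Pi.add_apply]
  simp
  ring

lemma oscillatorExpr_coherent {d : ℕ} (ν : ℝ) (z : Fin d → ℂ) (x : Rd d) :
    oscillatorExpr ν (coherent ν z) x = cohSymbol ν z x * coherent ν z x := by
  have dc := (contDiff_coherent ν z).differentiable (by simp)
  have h1 : ∀ i, pd i (pd i (coherent ν z)) x =
      ((z i - ν * (x i : ℂ)) ^ 2 - ν) * coherent ν z x := by
    intro i
    have hl : HasFDerivAt (fun x : Rd d ↦ z i - (ν : ℂ) * (x i : ℂ)) _ x :=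
      ((hasFDerivAt_coord i x).const_mul (ν : ℂ)).const_sub (z i)
    rw [pd_coherent, pd_mul hl.differentiableAt (dc x), pd_coherent]
    unfold pd
    rw [hl.fderiv]
    simp
    ring
  rw [oscillatorExpr, laplacian_eq_sum_pd (contDiff_coherent ν z)]
  simp_rw [h1]
  rw [← Finset.sum_mul]
  have h2 : ∑ i, ((z i - ν * (x i : ℂ)) ^ 2 - ν) =
      ∑ i, z i ^ 2 - 2 * ν * (∑ i, z i * (x i : ℂ)) + ν ^ 2 * (‖x‖ : ℂ) ^ 2 - d * ν := by
    have h3 : (‖x‖ : ℂ) ^ 2 = ∑ i, (x i : ℂ) ^ 2 := by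
      rw [← Complex.ofReal_pow, EuclideanSpace.norm_sq_eq]; simp
    rw [h3, Finset.mul_sum, Finset.mul_sum, Finset.sum_sub_distrib]
    congr 1
    · rw [← Finset.sum_sub_distrib, ← Finset.sum_add_distrib]
      exact Finset.sum_congr rfl fun i _ ↦ by ring
    · simp
  rw [h2, cohSymbol]
  ring

/-- Symmetry of the operator; the conjugate of a coherent state is the coherent state of conjugate
parameter, so the same differential identity applies to it. -/
lemma inner_oscCohLp_eq_of_mem_testGraph {d : ℕ} {ν : ℝ} (hν : 0 < ν) (z : Fin d → ℂ)
    {p : L2 d × L2 d} (hp : p ∈ testGraph d ν) :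
    inner ℂ (oscCohLp hν z) p.1 = inner ℂ (cohLp hν z) p.2 := by
  obtain ⟨φ, hφ, hc, h1, h2⟩ := hp
  rw [inner_oscCohLp_left, inner_cohLp_left]
  set w : Fin d → ℂ := fun i ↦ (starRingEnd ℂ) (z i)
  have hG := contDiff_coherent ν w
  have e1 : ∫ x, (starRingEnd ℂ) (cohSymbol ν z x * coherent ν z x) * p.1 x =
      ∫ x, (1 / 2 : ℂ) * ((ν : ℂ) ^ 2 * (‖x‖ : ℂ) ^ 2 * (coherent ν w x * φ x)) -
        (1 / 2 : ℂ) * ((Δ (coherent ν w)) x * φ x) := by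
    refine integral_congr_ae ?_
    filter_upwards [h1] with x hx
    rw [hx, map_mul, conj_cohSymbol, conj_coherent, ← oscillatorExpr_coherent, oscillatorExpr]
    ring
  have e2 : ∫ x, (starRingEnd ℂ) (coherent ν z x) * p.2 x =
      ∫ x, (1 / 2 : ℂ) * ((ν : ℂ) ^ 2 * (‖x‖ : ℂ) ^ 2 * (coherent ν w x * φ x)) -
        (1 / 2 : ℂ) * (coherent ν w x * (Δ φ) x) := by
    refine integral_congr_ae ?_
    filter_upwards [h2] with x hx
    rw [hx, conj_coherent, oscillatorExpr]
    ring
  have c1 := continuous_laplacian hG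
  have c2 := continuous_laplacian hφ
  have c3 := hG.continuous
  have c4 := hφ.continuous
  have i1 : Integrable fun x : Rd d ↦
      (1 / 2 : ℂ) * ((ν : ℂ) ^ 2 * (‖x‖ : ℂ) ^ 2 * (coherent ν w x * φ x)) :=
    Continuous.integrable_of_hasCompactSupport (by fun_prop) hc.mul_left.mul_left.mul_left
  have i2 : Integrable fun x : Rd d ↦ (1 / 2 : ℂ) * ((Δ (coherent ν w)) x * φ x) :=
    Continuous.integrable_of_hasCompactSupport (by fun_prop) hc.mul_left.mul_left
  have i3 : Integrable fun x : Rd d ↦ (1 / 2 : ℂ) * (coherent ν w x * (Δ φ) x) :=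
    Continuous.integrable_of_hasCompactSupport (by fun_prop)
      (hasCompactSupport_laplacian hφ hc).mul_left.mul_left
  rw [e1, e2, integral_sub i1 i2, integral_sub i1 i3, integral_const_mul (1 / 2 : ℂ),
    integral_const_mul (1 / 2 : ℂ), integral_const_mul (1 / 2 : ℂ),
    integral_mul_laplacian hG hφ hc]

/-- The linear bound at the origin becomes `a ‖x‖` for the dilated cutoff `X (a • x)`, an explicit
rate as `a → 0`. -/
lemma exists_smooth_cutoff (d : ℕ) : ∃ X : Rd d → ℂ, ContDiff ℝ ((⊤ : ℕ∞) : WithTop ℕ∞) X ∧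
    HasCompactSupport X ∧ ∀ x, ‖X x - 1‖ ≤ ‖x‖ := by
  let χ : ContDiffBump (0 : Rd d) := ⟨1, 2, one_pos, one_lt_two⟩
  refine ⟨fun x ↦ (χ x : ℂ), Complex.ofRealCLM.contDiff.comp χ.contDiff,
    χ.hasCompactSupport.comp_left Complex.ofReal_zero, fun x ↦ ?_⟩
  rw [← Complex.ofReal_one, ← Complex.ofReal_sub, Complex.norm_real, Real.norm_eq_abs]
  rcases le_total ‖x‖ 1 with h | h
  · have : χ x = 1 := χ.one_of_mem_closedBall (by simpa [χ] using h)
    simp [this]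
  · have h0 := χ.nonneg (x := x)
    have h1 := χ.le_one (x := x)
    rw [abs_le]
    constructor <;> linarith

lemma mem_closure_prod_of_forall_norm_le {E F : Type*} [NormedAddCommGroup E]
    [NormedAddCommGroup F] {A : Set (E × F)} {u : E} {v : F} {K : ℝ}
    (h : ∀ a : ℝ, 0 < a → a ≤ 1 → ∃ p ∈ A, ‖p.1 - u‖ ≤ a * K ∧ ‖p.2 - v‖ ≤ a * K) :
    (u, v) ∈ closure A := by
  rw [Metric.mem_closure_iff]
  intro ε hε
  have hK : 0 < |K| + 1 := by positivity
  obtain ⟨p, hp, h1, h2⟩ := h (min 1 (ε / (2 * (|K| + 1)))) (by positivity) (min_le_left _ _)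
  have hb : min 1 (ε / (2 * (|K| + 1))) * K < ε := by
    calc min 1 (ε / (2 * (|K| + 1))) * K ≤ min 1 (ε / (2 * (|K| + 1))) * (|K| + 1) := by
          gcongr; linarith [le_abs_self K]
      _ ≤ ε / (2 * (|K| + 1)) * (|K| + 1) := by gcongr; exact min_le_right _ _
      _ = ε / 2 := by field_simp
      _ < ε := by linarith
  refine ⟨p, hp, ?_⟩
  rw [dist_comm, Prod.dist_eq, max_lt_iff, dist_eq_norm, dist_eq_norm]
  exact ⟨h1.trans_lt hb, h2.trans_lt hb⟩

/-- Coherent states are in the domain of the closed harmonic oscillator. -/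
lemma cohLp_mem_oscillatorGraph {d : ℕ} {ν : ℝ} (hν : 0 < ν) (z : Fin d → ℂ) :
    (cohLp hν z, oscCohLp hν z) ∈ oscillatorGraph d ν := by
  obtain ⟨X, hX, hXc, hX1⟩ := exists_smooth_cutoff d
  have hpd : ∀ i : Fin d, ∃ C, ∀ x, ‖pd i X x‖ ≤ C := fun i ↦
    (hX.pd i).continuous.bounded_above_of_compact_support (hXc.pd i)
  choose C hC using hpd
  obtain ⟨L, hL⟩ := (continuous_laplacian hX).bounded_above_of_compact_support
    (hasCompactSupport_laplacian hX hXc)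
  have hC0 : ∀ i, 0 ≤ C i := fun i ↦ (norm_nonneg _).trans (hC i 0)
  have hL0 : 0 ≤ L := (norm_nonneg _).trans (hL 0)
  set N := ∑ i, ‖z i‖ with hN
  set E := Real.exp ((∑ i, ‖z i‖ ^ 2) / (4 * ν)) with hE
  set K := (ν * N + (∑ i, ‖z i‖ ^ 2) + ν * d) * E with hK
  have hN0 : 0 ≤ N := by positivity
  have hE0 : 0 ≤ E := by positivity
  have hK0 : 0 ≤ K := by positivity
  set M := E + K + (∑ i, C i) * (N + ν) * E + L * E with hM
  have hS0 : 0 ≤ ∑ i, C i := Finset.sum_nonneg fun i _ ↦ hC0 i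
  refine mem_closure_prod_of_forall_norm_le
    (K := M * ‖(memLp_envelope (d := d) hν (N + 1 + 1)).toLp‖) fun a ha ha1 ↦ ?_
  have hG := contDiff_coherent ν z
  have hXa : ContDiff ℝ ((⊤ : ℕ∞) : WithTop ℕ∞) fun y ↦ X (a • y) :=
    hX.comp (contDiff_const_smul a)
  have hXac : HasCompactSupport fun y ↦ X (a • y) := hXc.comp_smul ha.ne'
  have hφ : ContDiff ℝ ((⊤ : ℕ∞) : WithTop ℕ∞) fun y ↦ X (a • y) * coherent ν z y := hXa.mul hG
  have hφc : HasCompactSupport fun y ↦ X (a • y) * coherent ν z y := hXac.mul_right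
  have m1 : MemLp (fun y ↦ X (a • y) * coherent ν z y) 2 volume :=
    hφ.continuous.memLp_of_hasCompactSupport hφc
  have m2 : MemLp (oscillatorExpr ν fun y ↦ X (a • y) * coherent ν z y) 2 volume :=
    (continuous_oscillatorExpr ν hφ).memLp_of_hasCompactSupport
      (hasCompactSupport_oscillatorExpr ν hφ hφc)
  have hXb : ∀ x, ‖X (a • x) - 1‖ ≤ a * ‖x‖ := fun x ↦ by
    simpa [norm_smul, abs_of_pos ha] using hX1 (a • x)
  have hcb : ∀ x, ‖coherent ν z x‖ ≤ E * envelope ν N x := fun x ↦ norm_coherent_le hν z x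
  have henv : ∀ x : Rd d, ‖x‖ * envelope ν (N + 1) x ≤ envelope ν (N + 1 + 1) x := fun x ↦
    (mul_le_mul_of_nonneg_right (by linarith) (envelope_nonneg _ _ _)).trans
      (one_add_norm_mul_envelope_le ν (N + 1) x)
  have henv1 : ∀ x : Rd d, (1 + ‖x‖) * envelope ν N x ≤ envelope ν (N + 1 + 1) x := fun x ↦
    (one_add_norm_mul_envelope_le ν N x).trans (envelope_mono ν (by linarith) x)
  have henv0 : ∀ x : Rd d, envelope ν N x ≤ envelope ν (N + 1 + 1) x := fun x ↦
    envelope_mono ν (by linarith) x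
  refine ⟨(m1.toLp, m2.toLp), ⟨_, hφ, hφc, m1.coeFn_toLp, m2.coeFn_toLp⟩, ?_, ?_⟩
  · rw [← mul_assoc]
    refine norm_le_mul_norm_envelope hν ?_
    filter_upwards [Lp.coeFn_sub m1.toLp (cohLp hν z), m1.coeFn_toLp, coeFn_cohLp hν z]
      with x e1 e2 e3
    rw [e1, Pi.sub_apply, e2, e3]
    have e0 := envelope_nonneg ν N x
    calc ‖X (a • x) * coherent ν z x - coherent ν z x‖
        = ‖X (a • x) - 1‖ * ‖coherent ν z x‖ := by rw [← norm_mul]; ring_nf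
      _ ≤ (a * ‖x‖) * (E * envelope ν N x) := by
          gcongr
          · exact hXb x
          · exact hcb x
      _ = a * E * (‖x‖ * envelope ν N x) := by ring
      _ ≤ a * E * ((1 + ‖x‖) * envelope ν N x) := by gcongr; linarith
      _ ≤ a * E * envelope ν (N + 1 + 1) x := by gcongr; exact henv1 x
      _ ≤ a * M * envelope ν (N + 1 + 1) x := by
          refine mul_le_mul_of_nonneg_right (mul_le_mul_of_nonneg_left ?_ ha.le)
            (envelope_nonneg _ _ _)
          have : 0 ≤ K + (∑ i, C i) * (N + ν) * E + L * E := by positivity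
          linarith
  · rw [← mul_assoc]
    refine norm_le_mul_norm_envelope hν ?_
    filter_upwards [Lp.coeFn_sub m2.toLp (oscCohLp hν z), m2.coeFn_toLp, coeFn_oscCohLp hν z]
      with x e1 e2 e3
    rw [e1, Pi.sub_apply, e2, e3]
    have e0 := envelope_nonneg ν N x
    -- Leibniz rule: the error is the cutoff defect, of size `a ‖x‖`, plus a gradient term carrying
    -- `a` and a Laplacian term carrying `a ^ 2`.
    have hex : oscillatorExpr ν (fun y ↦ X (a • y) * coherent ν z y) x -
        cohSymbol ν z x * coherent ν z x =
        (X (a • x) - 1) * (cohSymbol ν z x * coherent ν z x) -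
        (∑ i, (a * pd i X (a • x)) * ((z i - ν * (x i : ℂ)) * coherent ν z x)) -
        (1 / 2 : ℂ) * ((a : ℂ) ^ 2 * (Δ X) (a • x) * coherent ν z x) := by
      have h1 := oscillatorExpr_coherent ν z x
      unfold oscillatorExpr at h1 ⊢
      rw [← h1, laplacian_mul hXa hG, laplacian_comp_smul hX]
      simp_rw [pd_comp_smul, pd_coherent]
      ring
    rw [hex]
    have b1 : ‖(X (a • x) - 1) * (cohSymbol ν z x * coherent ν z x)‖ ≤
        a * K * envelope ν (N + 1 + 1) x := by
      rw [norm_mul]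
      calc _ ≤ (a * ‖x‖) * (K * envelope ν (N + 1) x) := by
            gcongr
            · exact hXb x
            · exact norm_cohSymbol_mul_coherent_le hν z x
        _ = a * K * (‖x‖ * envelope ν (N + 1) x) := by ring
        _ ≤ _ := by gcongr; exact henv x
    have b2 : ‖∑ i, (a * pd i X (a • x)) * ((z i - ν * (x i : ℂ)) * coherent ν z x)‖ ≤
        a * ((∑ i, C i) * (N + ν) * E) * envelope ν (N + 1 + 1) x := by
      have hz : ∀ i, ‖z i - ν * (x i : ℂ)‖ ≤ (N + ν) * (1 + ‖x‖) := by
        intro i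
        have z1 : ‖z i‖ ≤ N := Finset.single_le_sum (f := fun i ↦ ‖z i‖)
          (fun j _ ↦ norm_nonneg (z j)) (Finset.mem_univ i)
        have z2 : ‖x i‖ ≤ ‖x‖ := PiLp.norm_apply_le x i
        refine (norm_sub_le _ _).trans ?_
        rw [norm_mul, Complex.norm_real, Complex.norm_real, Real.norm_of_nonneg hν.le]
        have z3 : ν * ‖x i‖ ≤ ν * ‖x‖ := by gcongr
        nlinarith [mul_nonneg hN0 (norm_nonneg x)]
      refine (norm_sum_le _ _).trans ?_
      calc _ ≤ ∑ i, (a * C i) * (((N + ν) * (1 + ‖x‖)) * (E * envelope ν N x)) := by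
            refine Finset.sum_le_sum fun i _ ↦ ?_
            rw [norm_mul, norm_mul, norm_mul, Complex.norm_real, Real.norm_of_nonneg ha.le]
            have := hC i (a • x)
            have := hz i
            have := hcb x
            have := hC0 i
            gcongr
        _ = a * ((∑ i, C i) * (N + ν) * E) * ((1 + ‖x‖) * envelope ν N x) := by
            rw [← Finset.sum_mul, ← Finset.mul_sum]; ring
        _ ≤ _ := by gcongr; exact henv1 x
    have b3 : ‖(1 / 2 : ℂ) * ((a : ℂ) ^ 2 * (Δ X) (a • x) * coherent ν z x)‖ ≤
        a * (L * E) * envelope ν (N + 1 + 1) x := by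
      rw [norm_mul, norm_mul, norm_mul, norm_pow, Complex.norm_real, Real.norm_of_nonneg ha.le]
      have h12 : ‖(1 / 2 : ℂ)‖ ≤ 1 := by norm_num
      calc _ ≤ 1 * (a ^ 2 * L * (E * envelope ν (N + 1 + 1) x)) := by
            gcongr
            · exact hL _
            · exact (hcb x).trans (by gcongr; exact henv0 x)
        _ ≤ 1 * (a * L * (E * envelope ν (N + 1 + 1) x)) := by
            have := envelope_nonneg ν (N + 1 + 1) x
            gcongr
            nlinarith
        _ = _ := by ring
    have hEE : 0 ≤ a * E * envelope ν (N + 1 + 1) x :=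
      mul_nonneg (by positivity) (envelope_nonneg _ _ _)
    refine (norm_sub_le _ _).trans ((add_le_add (norm_sub_le _ _) le_rfl).trans ?_)
    calc _ ≤ a * K * envelope ν (N + 1 + 1) x +
          a * ((∑ i, C i) * (N + ν) * E) * envelope ν (N + 1 + 1) x +
          a * (L * E) * envelope ν (N + 1 + 1) x := by gcongr
      _ ≤ a * E * envelope ν (N + 1 + 1) x + (a * K * envelope ν (N + 1 + 1) x +
          a * ((∑ i, C i) * (N + ν) * E) * envelope ν (N + 1 + 1) x +
          a * (L * E) * envelope ν (N + 1 + 1) x) := by linarith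
      _ = _ := by rw [hM]; ring

/-! ### Construction of the Schrödinger group -/

/-- The norm of a linear combination depends only on the Gram matrix. This makes the evolution well
defined and isometric on the span, although the coherent states are not known to be linearly
independent. -/
lemma norm_linearCombination_eq_of_inner_eq {ι E F : Type*} [NormedAddCommGroup E]
    [InnerProductSpace ℂ E] [NormedAddCommGroup F] [InnerProductSpace ℂ F] {v : ι → E} {w : ι → F}
    (h : ∀ i j, inner ℂ (v i) (v j) = inner ℂ (w i) (w j)) (c : ι →₀ ℂ) :
    ‖Finsupp.linearCombination ℂ v c‖ = ‖Finsupp.linearCombination ℂ w c‖ := by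
  have key : inner ℂ (Finsupp.linearCombination ℂ v c) (Finsupp.linearCombination ℂ v c) =
      inner ℂ (Finsupp.linearCombination ℂ w c) (Finsupp.linearCombination ℂ w c) := by
    simp only [Finsupp.linearCombination_apply, Finsupp.sum, sum_inner, inner_sum,
      inner_smul_left, inner_smul_right, h]
  rw [inner_self_eq_norm_sq_to_K, inner_self_eq_norm_sq_to_K] at key
  have key' : ‖Finsupp.linearCombination ℂ v c‖ ^ 2 = ‖Finsupp.linearCombination ℂ w c‖ ^ 2 := by
    exact_mod_cast key
  exact (pow_left_inj₀ (norm_nonneg _) (norm_nonneg _) two_ne_zero).1 key'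

/-- The time evolution of a coherent state. -/
noncomputable def evolvedCoh {d : ℕ} {ν : ℝ} (hν : 0 < ν) (t : ℝ) (z : Fin d → ℂ) : L2 d :=
  groundPhase d ν t • cohLp hν (rotate ν t z)

lemma evolvedCoh_zero {d : ℕ} {ν : ℝ} (hν : 0 < ν) (z : Fin d → ℂ) :
    evolvedCoh hν 0 z = cohLp hν z := by
  rw [evolvedCoh, groundPhase_zero, rotate_zero, one_smul]

lemma hasDerivAt_evolvedCoh {d : ℕ} {ν : ℝ} (hν : 0 < ν) (z : Fin d → ℂ) (t : ℝ) :
    HasDerivAt (fun t ↦ evolvedCoh hν t z)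
      ((-Complex.I) • groundPhase d ν t • oscCohLp hν (rotate ν t z)) t :=
  hasDerivAt_groundPhase_smul_cohLp hν z t

lemma continuous_evolvedCoh {d : ℕ} {ν : ℝ} (hν : 0 < ν) (z : Fin d → ℂ) :
    Continuous fun t ↦ evolvedCoh hν t z :=
  continuous_iff_continuousAt.2 fun t ↦ (hasDerivAt_evolvedCoh hν z t).continuousAt

lemma conj_mul_self_of_norm_eq_one {c : ℂ} (hc : ‖c‖ = 1) : (starRingEnd ℂ) c * c = 1 := by
  rw [mul_comm, Complex.mul_conj, Complex.normSq_eq_norm_sq, hc]; simp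

lemma inner_evolvedCoh {d : ℕ} {ν : ℝ} (hν : 0 < ν) (t : ℝ) (z w : Fin d → ℂ) :
    inner ℂ (evolvedCoh hν t z) (evolvedCoh hν t w) = inner ℂ (cohLp hν z) (cohLp hν w) := by
  rw [evolvedCoh, evolvedCoh, inner_smul_left, inner_smul_right, ← mul_assoc,
    conj_mul_self_of_norm_eq_one (norm_groundPhase d ν t), one_mul, inner_cohLp_cohLp,
    inner_cohLp_cohLp]
  congr 3
  refine Finset.sum_congr rfl fun i _ ↦ ?_
  have h := conj_mul_self_of_norm_eq_one (norm_exp_neg_mul_I ν t)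
  simp only [rotate, map_mul]
  calc _ = ((starRingEnd ℂ) (Complex.exp (-(ν * t) * Complex.I)) *
        Complex.exp (-(ν * t) * Complex.I)) * ((starRingEnd ℂ) (z i) * w i) := by ring
    _ = _ := by rw [h, one_mul]

lemma denseRange_linearCombination_cohLp {d : ℕ} {ν : ℝ} (hν : 0 < ν) :
    DenseRange (Finsupp.linearCombination ℂ (cohLp (d := d) hν)) := by
  have h : (Submodule.span ℂ (range (cohLp (d := d) hν))).topologicalClosure = ⊤ := by
    rw [Submodule.topologicalClosure_eq_top_iff, Submodule.eq_bot_iff]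
    intro u hu
    exact eq_zero_of_forall_inner_cohLp_eq_zero hν u fun z ↦
      (Submodule.mem_orthogonal _ _).1 hu _ (Submodule.subset_span ⟨z, rfl⟩)
  have h2 := (Submodule.dense_iff_topologicalClosure_eq_top).2 h
  rw [← Finsupp.range_linearCombination] at h2
  exact h2

lemma clm_ext_cohLp {d : ℕ} {ν : ℝ} (hν : 0 < ν) {A B : L2 d →L[ℂ] L2 d}
    (h : ∀ z, A (cohLp hν z) = B (cohLp hν z)) : A = B := by
  refine ContinuousLinearMap.ext fun u ↦ ?_
  refine congr_fun ((denseRange_linearCombination_cohLp hν).equalizer A.continuous B.continuous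
    (funext fun c ↦ ?_)) u
  simp only [Function.comp_apply, Finsupp.linearCombination_apply, Finsupp.sum, map_sum, map_smul,
    h]

/-- The unitary group defined by its action on coherent states. -/
noncomputable def cohGroup {d : ℕ} {ν : ℝ} (hν : 0 < ν) (t : ℝ) : L2 d →L[ℂ] L2 d :=
  (Finsupp.linearCombination ℂ (evolvedCoh hν t)).extendOfNorm
    (Finsupp.linearCombination ℂ (cohLp hν))

lemma norm_linearCombination_evolvedCoh {d : ℕ} {ν : ℝ} (hν : 0 < ν) (t : ℝ)
    (c : (Fin d → ℂ) →₀ ℂ) : ‖Finsupp.linearCombination ℂ (evolvedCoh hν t) c‖ =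
      ‖Finsupp.linearCombination ℂ (cohLp hν) c‖ :=
  norm_linearCombination_eq_of_inner_eq (inner_evolvedCoh hν t) c

lemma cohGroup_linearCombination {d : ℕ} {ν : ℝ} (hν : 0 < ν) (t : ℝ) (c : (Fin d → ℂ) →₀ ℂ) :
    cohGroup hν t (Finsupp.linearCombination ℂ (cohLp hν) c) =
      Finsupp.linearCombination ℂ (evolvedCoh hν t) c :=
  LinearMap.extendOfNorm_eq (denseRange_linearCombination_cohLp hν)
    ⟨1, fun c ↦ by rw [one_mul, norm_linearCombination_evolvedCoh]⟩ c

lemma cohGroup_cohLp {d : ℕ} {ν : ℝ} (hν : 0 < ν) (t : ℝ) (z : Fin d → ℂ) :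
    cohGroup hν t (cohLp hν z) = evolvedCoh hν t z := by
  simpa using cohGroup_linearCombination hν t (Finsupp.single z 1)

lemma norm_cohGroup_apply {d : ℕ} {ν : ℝ} (hν : 0 < ν) (t : ℝ) (u : L2 d) :
    ‖cohGroup hν t u‖ = ‖u‖ := by
  refine congr_fun ((denseRange_linearCombination_cohLp hν).equalizer
    (cohGroup hν t).continuous.norm continuous_norm (funext fun c ↦ ?_)) u
  simp only [Function.comp_apply]
  rw [cohGroup_linearCombination, norm_linearCombination_evolvedCoh]

lemma cohGroup_zero {d : ℕ} {ν : ℝ} (hν : 0 < ν) : cohGroup (d := d) hν 0 = 1 :=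
  clm_ext_cohLp hν fun z ↦ by rw [cohGroup_cohLp, evolvedCoh_zero]; rfl

lemma cohGroup_add {d : ℕ} {ν : ℝ} (hν : 0 < ν) (s t : ℝ) :
    cohGroup (d := d) hν (s + t) = cohGroup hν s * cohGroup hν t :=
  clm_ext_cohLp hν fun z ↦ by
    rw [cohGroup_cohLp]
    change _ = cohGroup hν s (cohGroup hν t (cohLp hν z))
    rw [cohGroup_cohLp, evolvedCoh, evolvedCoh, map_smul, cohGroup_cohLp, evolvedCoh,
      rotate_rotate, smul_smul, groundPhase_add, mul_comm]

/-- An isometry with a right inverse, here the evolution at time `-t`, is unitary. -/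
lemma cohGroup_mem_unitary {d : ℕ} {ν : ℝ} (hν : 0 < ν) (t : ℝ) :
    cohGroup (d := d) hν t ∈ unitary (L2 d →L[ℂ] L2 d) := by
  have h1 : star (cohGroup (d := d) hν t) * cohGroup hν t = 1 :=
    (ContinuousLinearMap.norm_map_iff_adjoint_comp_self _).1 (norm_cohGroup_apply hν t)
  have h2 : cohGroup (d := d) hν t * cohGroup hν (-t) = 1 := by
    rw [← cohGroup_add, add_neg_cancel, cohGroup_zero]
  rw [Unitary.mem_iff]
  refine ⟨h1, ?_⟩
  have h3 : star (cohGroup (d := d) hν t) = cohGroup hν (-t) := left_inv_eq_right_inv h1 h2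
  rw [h3, h2]

lemma inner_cohLp_cohGroup {d : ℕ} {ν : ℝ} (hν : 0 < ν) (t : ℝ) (z : Fin d → ℂ) (u : L2 d) :
    inner ℂ (cohLp hν z) (cohGroup hν t u) = inner ℂ (evolvedCoh hν (-t) z) u := by
  have h1 := (ContinuousLinearMap.inner_map_map_iff_adjoint_comp_self _).2
    ((ContinuousLinearMap.norm_map_iff_adjoint_comp_self _).1 (norm_cohGroup_apply (d := d) hν (-t)))
  rw [← h1, cohGroup_cohLp]
  congr 1
  change (cohGroup (d := d) hν (-t) * cohGroup (d := d) hν t) u = u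
  rw [← cohGroup_add, neg_add_cancel, cohGroup_zero]
  rfl

lemma continuous_cohGroup {d : ℕ} {ν : ℝ} (hν : 0 < ν) (u : L2 d) :
    Continuous fun t ↦ cohGroup hν t u := by
  refine continuous_of_uniform_approx_of_continuous fun s hs ↦ ?_
  obtain ⟨ε, hε, hεs⟩ := Metric.mem_uniformity_dist.1 hs
  obtain ⟨c, hc⟩ := (denseRange_linearCombination_cohLp (d := d) hν).exists_dist_lt u hε
  refine ⟨fun t ↦ Finsupp.linearCombination ℂ (evolvedCoh hν t) c, ?_, fun t ↦ hεs ?_⟩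
  · simp only [Finsupp.linearCombination_apply, Finsupp.sum]
    exact continuous_finsetSum _ fun z _ ↦ (continuous_evolvedCoh hν z).fun_const_smul _
  · dsimp only
    rw [← cohGroup_linearCombination, dist_eq_norm, ← map_sub, norm_cohGroup_apply, ← dist_eq_norm]
    exact hc

/-! ### The generator -/

lemma hasDerivAt_inner_evolvedCoh_neg {d : ℕ} {ν : ℝ} (hν : 0 < ν) {u v : L2 d}
    (h : ∀ z, inner ℂ (oscCohLp hν z) u = inner ℂ (cohLp hν z) v) (z : Fin d → ℂ) (t : ℝ) :
    HasDerivAt (fun t ↦ inner ℂ (evolvedCoh hν (-t) z) u)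
      (-Complex.I * inner ℂ (evolvedCoh hν (-t) z) v) t := by
  have h1 : HasDerivAt (fun t ↦ evolvedCoh hν (-t) z)
      ((-1 : ℝ) • ((-Complex.I) • groundPhase d ν (-t) • oscCohLp hν (rotate ν (-t) z))) t :=
    (hasDerivAt_evolvedCoh hν z (-t)).scomp t (hasDerivAt_neg t)
  refine ((h1.inner ℂ (hasDerivAt_const t u))).congr_deriv ?_
  rw [inner_zero_right, zero_add, neg_smul, one_smul, neg_smul, neg_neg, inner_smul_left,
    inner_smul_left, h, evolvedCoh, inner_smul_left, Complex.conj_I]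

/-- Paired with any coherent state, both sides have the same time derivative and the same value at
time zero. The relation between `u` and `v` is needed only weakly, against coherent states, because
the adjoint evolution keeps coherent states coherent up to a phase. -/
lemma cohGroup_eq_add_integral {d : ℕ} {ν : ℝ} (hν : 0 < ν) {u v : L2 d}
    (h : ∀ z, inner ℂ (oscCohLp hν z) u = inner ℂ (cohLp hν z) v) (t : ℝ) :
    cohGroup hν t u = u + (-Complex.I) • ∫ s in (0 : ℝ)..t, cohGroup hν s v := by
  rw [← sub_eq_zero]
  refine eq_zero_of_forall_inner_cohLp_eq_zero hν _ fun z ↦ ?_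
  have hd : ∀ t, HasDerivAt (fun t ↦ inner ℂ (cohLp hν z)
      (u + (-Complex.I) • ∫ s in (0 : ℝ)..t, cohGroup hν s v))
      (-Complex.I * inner ℂ (evolvedCoh hν (-t) z) v) t := by
    intro t
    have h1 := (((continuous_cohGroup hν v).integral_hasStrictDerivAt 0 t).hasDerivAt.const_smul
      (-Complex.I)).const_add u
    refine ((hasDerivAt_const t (cohLp hν z)).inner ℂ h1).congr_deriv ?_
    rw [inner_zero_left, add_zero, inner_smul_right, inner_cohLp_cohGroup]
  have hd' : ∀ t, HasDerivAt (fun t ↦ inner ℂ (evolvedCoh hν (-t) z) u -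
      inner ℂ (cohLp hν z) (u + (-Complex.I) • ∫ s in (0 : ℝ)..t, cohGroup hν s v)) 0 t := by
    intro t
    simpa using! (hasDerivAt_inner_evolvedCoh_neg hν h z t).sub (hd t)
  have hc := is_const_of_deriv_eq_zero (fun t ↦ (hd' t).differentiableAt)
    (fun t ↦ (hd' t).deriv) t 0
  rw [inner_sub_right, inner_cohLp_cohGroup]
  simpa [evolvedCoh_zero] using hc

lemma hasDerivAt_cohGroup_of_weak {d : ℕ} {ν : ℝ} (hν : 0 < ν) {u v : L2 d}
    (h : ∀ z, inner ℂ (oscCohLp hν z) u = inner ℂ (cohLp hν z) v) :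
    HasDerivAt (fun t ↦ cohGroup hν t u) ((-Complex.I) • v) 0 := by
  have h1 := (((continuous_cohGroup hν v).integral_hasStrictDerivAt 0 0).hasDerivAt.const_smul
      (-Complex.I)).const_add u
  rw [funext fun t ↦ cohGroup_eq_add_integral hν h t]
  refine h1.congr_deriv ?_
  rw [cohGroup_zero]; rfl

lemma hasDerivAt_cohGroup_of_mem_oscillatorGraph {d : ℕ} {ν : ℝ} (hν : 0 < ν) {u v : L2 d}
    (h : (u, v) ∈ oscillatorGraph d ν) :
    HasDerivAt (fun t ↦ cohGroup hν t u) ((-Complex.I) • v) 0 := by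
  refine hasDerivAt_cohGroup_of_weak hν fun z ↦ ?_
  have hcl : IsClosed {p : L2 d × L2 d | inner ℂ (oscCohLp hν z) p.1 = inner ℂ (cohLp hν z) p.2} :=
    isClosed_eq (by fun_prop) (by fun_prop)
  exact closure_minimal (fun p hp ↦ inner_oscCohLp_eq_of_mem_testGraph hν z hp) hcl h

/-- The graph of the oscillator on test functions, as a subspace. -/
def testSubmodule (d : ℕ) (ν : ℝ) : Submodule ℂ (L2 d × L2 d) where
  carrier := testGraph d ν
  zero_mem' := by
    refine ⟨0, contDiff_const, HasCompactSupport.zero, Lp.coeFn_zero _ _ _, ?_⟩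
    have h : oscillatorExpr ν (0 : Rd d → ℂ) = 0 := by
      ext x
      have : (Δ (0 : Rd d → ℂ)) x = 0 := by
        rw [laplacian_eq_sum_pd (f := (0 : Rd d → ℂ)) contDiff_const]
        have h0 : ∀ i : Fin d, pd i (0 : Rd d → ℂ) = 0 := fun i ↦ by
          ext y; simp [pd]
        simp [h0]
      simp [oscillatorExpr, this]
    rw [h]
    exact Lp.coeFn_zero _ _ _
  add_mem' := by
    rintro p q ⟨φ, hφ, hφc, h1, h2⟩ ⟨ψ, hψ, hψc, h3, h4⟩
    refine ⟨φ + ψ, hφ.add hψ, hφc.add hψc, ?_, ?_⟩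
    · exact (Lp.coeFn_add _ _).trans (h1.add h3)
    · refine (Lp.coeFn_add _ _).trans ?_
      filter_upwards [h2, h4] with x e2 e4
      rw [Pi.add_apply, e2, e4]
      have := (hφ.of_le (m := 2) (WithTop.coe_le_coe.2 le_top)).contDiffAt.laplacian_add
        (x := x) (hψ.of_le (m := 2) (WithTop.coe_le_coe.2 le_top)).contDiffAt
      simp only [oscillatorExpr, Pi.add_apply, this]
      ring
  smul_mem' := by
    rintro c p ⟨φ, hφ, hφc, h1, h2⟩
    refine ⟨c • φ, hφ.const_smul c, hφc.smul_left, ?_, ?_⟩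
    · exact (Lp.coeFn_smul _ _).trans (h1.const_smul c)
    · refine (Lp.coeFn_smul _ _).trans ?_
      filter_upwards [h2] with x e2
      rw [Pi.smul_apply, e2]
      have := InnerProductSpace.laplacian_smul (x := x) c
        (hφ.of_le (m := 2) (WithTop.coe_le_coe.2 le_top)).contDiffAt
      simp only [oscillatorExpr, Pi.smul_apply, this, smul_eq_mul]
      ring

/-- Differentiating the conserved norm at time zero kills the cross term. -/
lemma norm_add_I_smul_sq {d : ℕ} {ν : ℝ} (hν : 0 < ν) {u v : L2 d}
    (h : HasDerivAt (fun t ↦ cohGroup hν t u) ((-Complex.I) • v) 0) :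
    ‖v + Complex.I • u‖ ^ 2 = ‖v‖ ^ 2 + ‖u‖ ^ 2 := by
  have h1 := h.inner ℂ h
  simp only [cohGroup_zero, inner_self_eq_norm_sq_to_K, norm_cohGroup_apply] at h1
  have h2 := h1.unique (hasDerivAt_const (0 : ℝ) _)
  simp only [one_apply_eq_self] at h2
  rw [← inner_conj_symm u, add_comm, inner_smul_left, map_neg, Complex.conj_I, neg_neg] at h2
  have h3 : (Complex.I * inner ℂ v u).re = 0 := by
    have := congrArg Complex.re h2
    simp only [Complex.add_re, Complex.conj_re, Complex.zero_re] at this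
    linarith
  rw [norm_add_sq (𝕜 := ℂ), inner_smul_right, norm_smul, Complex.norm_I, one_mul]
  change ‖v‖ ^ 2 + 2 * (Complex.I * inner ℂ v u).re + ‖u‖ ^ 2 = _
  rw [h3]; ring

/-- Von Neumann's criterion: `P + i` has dense range already on coherent states. For `w` orthogonal
to this range, `exp t` times the inner product of the evolved coherent state with `w` is constant in
`t`; since the evolution is isometric it tends to zero as `t → -∞`, so it vanishes. -/
lemma dense_span_oscCohLp_add_I_smul {d : ℕ} {ν : ℝ} (hν : 0 < ν) :
    Dense (Submodule.span ℂ (range fun z : Fin d → ℂ ↦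
      oscCohLp hν z + Complex.I • cohLp hν z) : Set (L2 d)) := by
  rw [Submodule.dense_iff_topologicalClosure_eq_top, Submodule.topologicalClosure_eq_top_iff,
    Submodule.eq_bot_iff]
  intro w hw
  have hw' : ∀ z, inner ℂ (oscCohLp hν z) w = Complex.I * inner ℂ (cohLp hν z) w := by
    intro z
    have := (Submodule.mem_orthogonal _ _).1 hw _ (Submodule.subset_span ⟨z, rfl⟩)
    rw [inner_add_left, inner_smul_left, Complex.conj_I] at this
    linear_combination this
  refine eq_zero_of_forall_inner_cohLp_eq_zero hν w fun z ↦ ?_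
  have hd : ∀ t, HasDerivAt (fun t : ℝ ↦ (Real.exp t : ℂ) * inner ℂ (evolvedCoh hν t z) w) 0 t := by
    intro t
    have h1 := (hasDerivAt_evolvedCoh hν z t).inner ℂ (hasDerivAt_const t w)
    have h2 : HasDerivAt (fun t : ℝ ↦ (Real.exp t : ℂ)) (Real.exp t : ℂ) t :=
      (Real.hasDerivAt_exp t).ofReal_comp
    refine (h2.mul h1).congr_deriv ?_
    rw [inner_zero_right, zero_add, inner_smul_left, inner_smul_left, hw', evolvedCoh,
      inner_smul_left, map_neg, Complex.conj_I, neg_neg]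
    linear_combination (Real.exp t : ℂ) * (starRingEnd ℂ) (groundPhase d ν t) *
      inner ℂ (cohLp hν (rotate ν t z)) w * Complex.I_sq
  have hc : ∀ t, ‖inner ℂ (cohLp hν z) w‖ ≤ Real.exp t * (‖cohLp hν z‖ * ‖w‖) := by
    intro t
    have := is_const_of_deriv_eq_zero (fun t ↦ (hd t).differentiableAt) (fun t ↦ (hd t).deriv) 0 t
    simp only [Real.exp_zero, Complex.ofReal_one, one_mul, evolvedCoh_zero] at this
    rw [this, norm_mul, Complex.norm_real, Real.norm_of_nonneg (Real.exp_pos t).le]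
    gcongr
    refine (norm_inner_le_norm _ _).trans_eq ?_
    rw [← cohGroup_cohLp, norm_cohGroup_apply]
  have hlim : Tendsto (fun t ↦ Real.exp t * (‖cohLp hν z‖ * ‖w‖)) atBot (𝓝 0) := by
    simpa using Real.tendsto_exp_atBot.mul_const (‖cohLp hν z‖ * ‖w‖)
  exact norm_le_zero_iff.1 (ge_of_tendsto' hlim hc)

/-- The generator extends the closed operator, whose `P + i` has dense range. Approximating `v + iu`
by `p.2 + i p.1` with `p` in the closed graph, the identity `norm_add_I_smul_sq` for the difference
controls both components at once. -/
lemma mem_oscillatorGraph_of_hasDerivAt {d : ℕ} {ν : ℝ} (hν : 0 < ν) {u v : L2 d}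
    (h : HasDerivAt (fun t ↦ cohGroup hν t u) ((-Complex.I) • v) 0) :
    (u, v) ∈ oscillatorGraph d ν := by
  -- A second closure allows approximants from the closed graph, which contains the coherent states,
  -- instead of test functions.
  rw [oscillatorGraph, ← closure_closure, ← oscillatorGraph]
  refine mem_closure_prod_of_forall_norm_le (K := 1) fun ε hε _ ↦ ?_
  obtain ⟨r, hr, hrε⟩ := Metric.dense_iff.1 (dense_span_oscCohLp_add_I_smul (d := d) hν)
    (v + Complex.I • u) ε hε
  have key : ∀ r ∈ Submodule.span ℂ (range fun z : Fin d → ℂ ↦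
      oscCohLp hν z + Complex.I • cohLp hν z), ∃ p ∈ (testSubmodule d ν).topologicalClosure,
      r = p.2 + Complex.I • p.1 := by
    intro r hr
    induction hr using Submodule.span_induction with
    | mem x hx =>
      obtain ⟨z, rfl⟩ := hx
      exact ⟨_, cohLp_mem_oscillatorGraph hν z, rfl⟩
    | zero => exact ⟨0, zero_mem _, by simp⟩
    | add x y _ _ hx hy =>
      obtain ⟨p, hp, rfl⟩ := hx
      obtain ⟨q, hq, rfl⟩ := hy
      exact ⟨p + q, add_mem hp hq, by simp only [Prod.fst_add, Prod.snd_add, smul_add]; abel⟩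
    | smul c x _ hx =>
      obtain ⟨p, hp, rfl⟩ := hx
      exact ⟨c • p, Submodule.smul_mem _ c hp, by
        simp only [Prod.smul_fst, Prod.smul_snd, smul_add, smul_comm c Complex.I]⟩
  obtain ⟨p, hp, rfl⟩ := key r hrε
  have hp' : HasDerivAt (fun t ↦ cohGroup hν t p.1) ((-Complex.I) • p.2) 0 :=
    hasDerivAt_cohGroup_of_mem_oscillatorGraph hν hp
  have hdiff : HasDerivAt (fun t ↦ cohGroup hν t (p.1 - u)) ((-Complex.I) • (p.2 - v)) 0 := by
    simp only [map_sub, smul_sub]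
    exact hp'.sub h
  have hn := norm_add_I_smul_sq hν hdiff
  have hn2 : ‖p.2 - v + Complex.I • (p.1 - u)‖ < ε := by
    rw [mem_ball, dist_eq_norm] at hr
    rwa [smul_sub, sub_add_sub_comm]
  have hn3 : ‖p.2 - v + Complex.I • (p.1 - u)‖ ^ 2 ≤ ε ^ 2 := by gcongr
  refine ⟨p, hp, ?_, ?_⟩
  · rw [mul_one]
    exact abs_le_of_sq_le_sq' (by nlinarith [sq_nonneg ‖p.2 - v‖]) hε.le |>.2
  · rw [mul_one]
    exact abs_le_of_sq_le_sq' (by nlinarith [sq_nonneg ‖p.1 - u‖]) hε.le |>.2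

/-! ### Existence of the group, and its uniqueness on coherent states -/

lemma isSchrodingerGroup_cohGroup {d : ℕ} {ν : ℝ} (hν : 0 < ν) :
    IsSchrodingerGroup (d := d) ν (cohGroup hν) where
  unitary := cohGroup_mem_unitary hν
  zero := cohGroup_zero hν
  add := cohGroup_add hν
  continuous := continuous_cohGroup hν
  generator _ _ := ⟨hasDerivAt_cohGroup_of_mem_oscillatorGraph hν,
    mem_oscillatorGraph_of_hasDerivAt hν⟩

lemma isSchrodingerGroup_propagator {d : ℕ} {ν : ℝ} (hν : 0 < ν) :
    IsSchrodingerGroup ν (propagator d ν) := by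
  have h : ∃ U : ℝ → L2 d →L[ℂ] L2 d, IsSchrodingerGroup ν U := ⟨_, isSchrodingerGroup_cohGroup hν⟩
  rw [propagator, dif_pos h]
  exact h.choose_spec

lemma IsSchrodingerGroup.norm_apply {d : ℕ} {ν : ℝ} {U : ℝ → L2 d →L[ℂ] L2 d}
    (hU : IsSchrodingerGroup ν U) (t : ℝ) (u : L2 d) : ‖U t u‖ = ‖u‖ :=
  (ContinuousLinearMap.norm_map_iff_adjoint_comp_self _).2 (Unitary.mem_iff.1 (hU.unitary t)).1 u

/-- Uniqueness of the Schrödinger evolution of coherent states. -/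
lemma IsSchrodingerGroup.apply_cohLp {d : ℕ} {ν : ℝ} (hν : 0 < ν) {U : ℝ → L2 d →L[ℂ] L2 d}
    (hU : IsSchrodingerGroup ν U) (t : ℝ) (z : Fin d → ℂ) :
    U t (cohLp hν z) = evolvedCoh hν t z := by
  -- Interpolation between the two evolutions: the value is `U t (cohLp hν z)` at `s = 0` and
  -- `evolvedCoh hν t z` at `s = t`.
  have hd : ∀ s, HasDerivAt (fun s ↦ U (t - s) (evolvedCoh hν s z)) 0 s := by
    intro s
    have hmem : (evolvedCoh hν s z, groundPhase d ν s • oscCohLp hν (rotate ν s z)) ∈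
        oscillatorGraph d ν :=
      (testSubmodule d ν).topologicalClosure.smul_mem (groundPhase d ν s)
        (cohLp_mem_oscillatorGraph hν (rotate ν s z))
    have h1 := (hU.generator _ _).1 hmem
    have h2 : HasDerivAt (fun r ↦ U (r - s) (evolvedCoh hν s z))
        ((-Complex.I) • groundPhase d ν s • oscCohLp hν (rotate ν s z)) s := by
      have h1' : HasDerivAt (fun t ↦ U t (evolvedCoh hν s z))
        ((-Complex.I) • groundPhase d ν s • oscCohLp hν (rotate ν s z)) (s - s) := by
        rwa [sub_self]
      simpa using! h1'.comp_sub_const s s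
    have h3 := (hasDerivAt_evolvedCoh hν z s).sub h2
    rw [sub_self, hasDerivAt_iff_isLittleO] at h3
    rw [hasDerivAt_iff_isLittleO]
    -- Factoring out the isometry `U (t - r)` leaves the difference of two curves tangent at `s`, so
    -- no product rule for strongly continuous groups is needed.
    refine Asymptotics.IsLittleO.congr' (f₁ := fun r ↦ U (t - r) (evolvedCoh hν r z -
      U (r - s) (evolvedCoh hν s z))) (g₁ := fun r ↦ r - s) ?_ (Eventually.of_forall fun r ↦ ?_)
      EventuallyEq.rfl
    · rw [← Asymptotics.isLittleO_norm_left] at h3 ⊢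
      refine h3.congr_left fun r ↦ ?_
      rw [hU.norm_apply]
      simp [hU.zero]
    · simp only [smul_zero, sub_zero, map_sub]
      congr 1
      change (U (t - r) * U (r - s)) _ = _
      rw [← hU.add, sub_add_sub_cancel]
  have hc := is_const_of_deriv_eq_zero (fun t ↦ (hd t).differentiableAt) (fun t ↦ (hd t).deriv) 0 t
  simpa [hU.zero, evolvedCoh_zero] using hc

lemma propagator_cohLp {d : ℕ} {ν : ℝ} (hν : 0 < ν) (t : ℝ) (z : Fin d → ℂ) :
    propagator d ν t (cohLp hν z) = evolvedCoh hν t z :=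
  (isSchrodingerGroup_propagator hν).apply_cohLp hν t z

/-! ### Measure of conical shells -/

/-- The (non-normalized) surface measure of the unit sphere. -/
noncomputable abbrev surf (d : ℕ) : Measure (Sph d) := (volume : Measure (Rd d)).toSphere

lemma finrank_Rd (d : ℕ) : Module.finrank ℝ (Rd d) = d := by simp

lemma volumeIoiPow_Ico (n : ℕ) {a b : Ioi (0 : ℝ)} (hab : a ≤ b) :
    Measure.volumeIoiPow n (Ico a b) =
      ENNReal.ofReal ((b.1 ^ (n + 1) - a.1 ^ (n + 1)) / (n + 1)) := by
  have h : Ico a b = Iio b \ Iio a := by ext x; simp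
  have ha : (0 : ℝ) ≤ a.1 := le_of_lt a.2
  rw [h, measure_sdiff (Iio_subset_Iio hab) measurableSet_Iio.nullMeasurableSet
    (by rw [Measure.volumeIoiPow_apply_Iio]; exact ENNReal.ofReal_ne_top),
    Measure.volumeIoiPow_apply_Iio, Measure.volumeIoiPow_apply_Iio,
    ← ENNReal.ofReal_sub _ (by positivity), sub_div]

lemma volume_image_preimage_prod {d : ℕ} {Q : Set (Sph d)} (hQ : MeasurableSet Q)
    {J : Set (Ioi (0 : ℝ))} (hJ : MeasurableSet J) :
    volume ((↑) '' (homeomorphUnitSphereProd (Rd d) ⁻¹' (Q ×ˢ J)) : Set (Rd d)) =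
      surf d Q * Measure.volumeIoiPow (d - 1) J := by
  have h := (volume : Measure (Rd d)).measurePreserving_homeomorphUnitSphereProd.measure_preimage
    (hQ.prod hJ).nullMeasurableSet
  rw [comap_subtype_coe_apply (measurableSet_singleton _).compl, Measure.prod_prod,
    finrank_Rd] at h
  exact h

lemma volume_cone_inter_shell {d : ℕ} (hd : 1 ≤ d) {Q : Set (Sph d)} (hQ : MeasurableSet Q)
    {a b : ℝ} (ha : 0 < a) (hab : a ≤ b) :
    volume (cone Q ∩ {x | a ≤ ‖x‖ ∧ ‖x‖ < b}) =
      surf d Q * ENNReal.ofReal ((b ^ d - a ^ d) / d) := by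
  have h := volume_image_preimage_prod hQ
    (measurableSet_Ico (a := (⟨a, ha⟩ : Ioi (0 : ℝ))) (b := ⟨b, ha.trans_le hab⟩))
  rw [volumeIoiPow_Ico _ (by exact hab), Nat.sub_add_cancel hd, Nat.cast_pred hd,
    sub_add_cancel] at h
  rw [← h]
  congr 1
  ext x
  constructor
  · rintro ⟨⟨hx, θ, hθ, hθx⟩, h1, h2⟩
    refine ⟨⟨x, hx⟩, ⟨?_, ?_, ?_⟩, rfl⟩
    · convert hθ
      exact Subtype.ext ((homeomorphUnitSphereProd_apply_fst_coe _ _).trans hθx.symm)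
    · rw [← Subtype.coe_le_coe, homeomorphUnitSphereProd_apply_snd_coe]; exact h1
    · rw [← Subtype.coe_lt_coe, homeomorphUnitSphereProd_apply_snd_coe]; exact h2
  · rintro ⟨y, ⟨hy, h1, h2⟩, rfl⟩
    rw [← Subtype.coe_le_coe, homeomorphUnitSphereProd_apply_snd_coe] at h1
    rw [← Subtype.coe_lt_coe, homeomorphUnitSphereProd_apply_snd_coe] at h2
    exact ⟨⟨y.2, _, hy, homeomorphUnitSphereProd_apply_fst_coe _ _⟩, h1, h2⟩

/-- Polar coordinates over a measurable hull, so that `Q` itself need not be measurable. -/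
lemma volume_cone_eq_zero {d : ℕ} {Q : Set (Sph d)} (hQ : surf d Q = 0) :
    volume (cone Q) = 0 := by
  have h := volume_image_preimage_prod (measurableSet_toMeasurable (surf d) Q)
    (MeasurableSet.univ (α := Ioi (0 : ℝ)))
  rw [measure_toMeasurable, hQ, zero_mul] at h
  refine measure_mono_null ?_ h
  rintro x ⟨hx, θ, hθ, hθx⟩
  refine ⟨⟨x, hx⟩, ⟨?_, mem_univ _⟩, rfl⟩
  have : (homeomorphUnitSphereProd (Rd d) ⟨x, hx⟩).1 = θ :=
    Subtype.ext ((homeomorphUnitSphereProd_apply_fst_coe _ _).trans hθx.symm)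
  rw [this]
  exact subset_toMeasurable _ _ hθ

/-! ### Surface measure of spherical caps -/

/-- The displacement from `ρ • θ` is counted twice, once for the shift itself and once for the
change of radius. -/
lemma norm_inv_norm_smul_sub_le {E : Type*} [NormedAddCommGroup E] [NormedSpace ℝ E] {y θ : E}
    (hθ : ‖θ‖ = 1) (hy : y ≠ 0) {ρ : ℝ} (hρ : 0 < ρ) :
    ‖‖y‖⁻¹ • y - θ‖ ≤ 2 * ‖y - ρ • θ‖ / ρ := by
  have hy' : 0 < ‖y‖ := norm_pos_iff.2 hy
  have h1 : ‖y‖⁻¹ • y - θ = ρ⁻¹ • (y - ρ • θ) + (‖y‖⁻¹ - ρ⁻¹) • y := by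
    rw [smul_sub, smul_smul, inv_mul_cancel₀ hρ.ne', one_smul, sub_smul]; abel
  have h2 : ‖(‖y‖⁻¹ - ρ⁻¹) • y‖ ≤ ‖y - ρ • θ‖ / ρ := by
    have h3 : (‖y‖⁻¹ - ρ⁻¹) * ‖y‖ = (ρ - ‖y‖) / ρ := by field_simp
    have h4 : ‖(‖y‖⁻¹ - ρ⁻¹) • y‖ = |ρ - ‖y‖| / ρ := by
      rw [norm_smul, Real.norm_eq_abs, ← abs_of_pos hy', ← abs_mul, abs_of_pos hy', h3, abs_div,
        abs_of_pos hρ]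
    rw [h4]
    gcongr
    have h5 := abs_norm_sub_norm_le (ρ • θ) y
    rwa [norm_smul, hθ, mul_one, Real.norm_of_nonneg hρ.le, norm_sub_rev] at h5
  rw [h1]
  refine (norm_add_le _ _).trans ?_
  rw [norm_smul, norm_inv, Real.norm_of_nonneg hρ.le]
  calc ρ⁻¹ * ‖y - ρ • θ‖ + ‖(‖y‖⁻¹ - ρ⁻¹) • y‖ ≤ ρ⁻¹ * ‖y - ρ • θ‖ + ‖y - ρ • θ‖ / ρ := by gcongr
    _ = _ := by ring

lemma mem_cone_ball {d : ℕ} {θ : Sph d} {x : Rd d} {r : ℝ} (hx : x ≠ 0)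
    (h : ‖‖x‖⁻¹ • x - θ‖ < r) : x ∈ cone (ball θ r) := by
  refine ⟨hx, ⟨‖x‖⁻¹ • x, ?_⟩, ?_, rfl⟩
  · simp [norm_smul, hx]
  · rwa [mem_ball, Subtype.dist_eq, dist_eq_norm]

lemma volume_real_ball {d : ℕ} (x : Rd d) {r : ℝ} (hr : 0 < r) :
    volume.real (ball x r) = r ^ d * volume.real (ball (0 : Rd d) 1) := by
  have := Measure.addHaar_ball_of_pos (volume : Measure (Rd d)) x hr
  rw [finrank_Rd] at this
  rw [measureReal_def, this, ENNReal.toReal_mul, ENNReal.toReal_ofReal (by positivity),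
    measureReal_def]

/-- A Euclidean ball of radius `r / 4` fits in the cone over the cap, within the shell `1 - r ≤ ‖x‖
< 1`, whose radial mass is at most `r` by Bernoulli. The extra factor `r` avoids the exponent `d -
1`. -/
lemma pow_le_mul_surf_ball {d : ℕ} (hd : 1 ≤ d) (θ : Sph d) {r : ℝ} (hr : 0 < r)
    (hr2 : r ≤ 1 / 2) :
    volume.real (ball (0 : Rd d) 1) * (r / 4) ^ d ≤ r * (surf d).real (ball θ r) := by
  have hθ : ‖(θ : Rd d)‖ = 1 := by simp
  have hsub : ball ((1 - r / 2) • (θ : Rd d)) (r / 4) ⊆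
      cone (ball θ r) ∩ {x | 1 - r ≤ ‖x‖ ∧ ‖x‖ < 1} := by
    intro y hy
    rw [mem_ball, dist_eq_norm] at hy
    have h1 := abs_norm_sub_norm_le y ((1 - r / 2) • (θ : Rd d))
    rw [norm_smul, hθ, mul_one, Real.norm_of_nonneg (by linarith)] at h1
    have h2 := abs_le.1 (h1.trans hy.le)
    have h3 : |‖y‖ - (1 - r / 2)| < r / 4 := h1.trans_lt hy
    rw [abs_lt] at h3
    have hy0 : y ≠ 0 := norm_pos_iff.1 (by linarith)
    refine ⟨mem_cone_ball hy0 ?_, by constructor <;> linarith⟩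
    refine (norm_inv_norm_smul_sub_le hθ hy0 (ρ := 1 - r / 2) (by linarith)).trans_lt ?_
    rw [div_lt_iff₀ (by linarith)]
    nlinarith
  have hv := volume_cone_inter_shell hd (measurableSet_ball (x := θ) (ε := r)) (a := 1 - r) (b := 1)
    (by linarith) (by linarith)
  have hm : volume.real (ball ((1 - r / 2) • (θ : Rd d)) (r / 4)) ≤
      (surf d).real (ball θ r) * ((1 ^ d - (1 - r) ^ d) / d) := by
    have h := measure_mono (μ := volume) hsub
    rw [hv] at h
    have h' := ENNReal.toReal_mono (ENNReal.mul_ne_top (measure_ne_top _ _) ENNReal.ofReal_ne_top) h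
    rw [ENNReal.toReal_mul, ENNReal.toReal_ofReal] at h'
    · exact h'
    · rw [one_pow]
      have : (1 - r) ^ d ≤ 1 := pow_le_one₀ (by linarith) (by linarith)
      exact div_nonneg (by linarith) (by positivity)
  rw [volume_real_ball _ (by positivity)] at hm
  have hb : (1 ^ d - (1 - r) ^ d) / (d : ℝ) ≤ r := by
    have hd' : (0 : ℝ) < d := by exact_mod_cast hd
    rw [div_le_iff₀ hd', one_pow]
    have := one_add_mul_le_pow (a := -r) (by linarith) d
    have h2 : (1 + -r) ^ d = (1 - r) ^ d := by ring_nf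
    nlinarith
  calc _ = (r / 4) ^ d * volume.real (ball (0 : Rd d) 1) := mul_comm _ _
    _ ≤ _ := hm
    _ ≤ (surf d).real (ball θ r) * r := by gcongr
    _ = _ := mul_comm _ _

/-- Conversely, the part of the cone over the cap in this shell lies in a Euclidean ball of radius
`3 * r`. -/
lemma mul_surf_closedBall_le {d : ℕ} (hd : 1 ≤ d) (θ : Sph d) {r : ℝ} (hr : 0 < r)
    (hr2 : r ≤ 1 / 2) :
    r * (surf d).real (closedBall θ r) ≤ d * (volume.real (ball (0 : Rd d) 1) * (3 * r) ^ d) := by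
  have hθ : ‖(θ : Rd d)‖ = 1 := by simp
  have hd' : (0 : ℝ) < d := by exact_mod_cast hd
  have hsub : cone (closedBall θ r) ∩ {x | 1 - r ≤ ‖x‖ ∧ ‖x‖ < 1} ⊆ ball (θ : Rd d) (3 * r) := by
    rintro x ⟨⟨hx0, η, hη, hηx⟩, h1, h2⟩
    rw [mem_closedBall, Subtype.dist_eq, hηx, dist_eq_norm] at hη
    have h3 : x - θ = ‖x‖ • (‖x‖⁻¹ • x - θ) - (1 - ‖x‖) • (θ : Rd d) := by
      rw [smul_sub, smul_smul, mul_inv_cancel₀ (norm_ne_zero_iff.2 hx0), sub_smul]; simp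
    rw [mem_ball, dist_eq_norm, h3]
    refine (norm_sub_le _ _).trans_lt ?_
    rw [norm_smul, norm_smul, hθ, norm_norm, Real.norm_of_nonneg (by linarith)]
    nlinarith [norm_nonneg x]
  have hv := volume_cone_inter_shell hd (measurableSet_closedBall (x := θ) (ε := r))
    (a := 1 - r) (b := 1) (by linarith) (by linarith)
  have hle : (1 - r) ^ d ≤ 1 - r := pow_le_of_le_one (by linarith) (by linarith) (by omega)
  have hm : (surf d).real (closedBall θ r) * ((1 ^ d - (1 - r) ^ d) / d) ≤
      volume.real (ball (θ : Rd d) (3 * r)) := by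
    have h := measure_mono (μ := volume) hsub
    rw [hv] at h
    have h' := ENNReal.toReal_mono measure_ball_lt_top.ne h
    rw [ENNReal.toReal_mul, ENNReal.toReal_ofReal] at h'
    · exact h'
    · rw [one_pow]
      exact div_nonneg (by linarith) (by positivity)
  rw [volume_real_ball _ (by positivity)] at hm
  calc r * (surf d).real (closedBall θ r) = d * ((surf d).real (closedBall θ r) * (r / d)) := by
        field_simp
    _ ≤ d * ((surf d).real (closedBall θ r) * ((1 ^ d - (1 - r) ^ d) / d)) := by
        gcongr
        rw [one_pow]; linarith
    _ ≤ _ := by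
        rw [mul_comm (volume.real _)]
        gcongr

lemma surf_closedBall_two_mul_le {d : ℕ} (hd : 1 ≤ d) (θ : Sph d) {r : ℝ} (hr : 0 < r)
    (hr2 : r ≤ 1 / 4) :
    surf d (closedBall θ (2 * r)) ≤ ((d * 24 ^ d : ℕ) : ℝ≥0∞) * surf d (ball θ r) := by
  have h1 := mul_surf_closedBall_le hd θ (r := 2 * r) (by linarith) (by linarith)
  have h2 := pow_le_mul_surf_ball hd θ hr (by linarith)
  have h3 : (surf d).real (closedBall θ (2 * r)) ≤
      (d * 24 ^ d : ℕ) * (surf d).real (ball θ r) := by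
    -- Origin of the constant 24: ratio of the outer radius `3 * (2 * r)` to the inner radius `r /
    -- 4`.
    have h4 : (3 * (2 * r)) ^ d = 24 ^ d * (r / 4) ^ d := by rw [← mul_pow]; ring_nf
    rw [h4] at h1
    have h5 : r * (surf d).real (closedBall θ (2 * r)) ≤
        r * ((d * 24 ^ d : ℕ) * (surf d).real (ball θ r)) := by
      have h6 : 0 ≤ r * (surf d).real (closedBall θ (2 * r)) := by positivity
      push_cast
      calc r * (surf d).real (closedBall θ (2 * r))
          ≤ 2 * r * (surf d).real (closedBall θ (2 * r)) := by linarith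
        _ ≤ _ := h1
        _ = d * 24 ^ d * (volume.real (ball (0 : Rd d) 1) * (r / 4) ^ d) := by ring
        _ ≤ d * 24 ^ d * (r * (surf d).real (ball θ r)) := by gcongr
        _ = _ := by ring
    exact le_of_mul_le_mul_left h5 hr
  have h7 := ENNReal.ofReal_le_ofReal h3
  rw [ENNReal.ofReal_mul (by positivity), ENNReal.ofReal_natCast] at h7
  simpa [measureReal_def, ENNReal.ofReal_toReal, measure_ne_top] using h7

lemma isUnifLocDoublingMeasure_surf {d : ℕ} (hd : 1 ≤ d) : IsUnifLocDoublingMeasure (surf d) := by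
  refine ⟨⟨((d * 24 ^ d : ℕ) : NNReal), ?_⟩⟩
  filter_upwards [Ioc_mem_nhdsGT (show (0 : ℝ) < 1 / 4 by norm_num)] with r hr θ
  refine (surf_closedBall_two_mul_le hd θ hr.1 hr.2).trans ?_
  rw [ENNReal.coe_natCast]
  gcongr
  exact ball_subset_closedBall

/-! ### Densities -/

lemma surf_univ_ne_zero {d : ℕ} (hd : 1 ≤ d) : surf d univ ≠ 0 := by
  rw [Measure.toSphere_apply_univ, finrank_Rd]
  refine mul_ne_zero (by exact_mod_cast (by omega)) (measure_ball_pos _ _ one_pos).ne'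

lemma surf_ball_pos {d : ℕ} (θ : Sph d) {r : ℝ} (hr : 0 < r) : 0 < surf d (ball θ r) :=
  measure_ball_pos _ _ hr

lemma sphereProb_apply {d : ℕ} (A : Set (Sph d)) :
    sphereProb d A = (surf d univ)⁻¹ * surf d A := by
  rw [sphereProb, Measure.smul_apply, smul_eq_mul]

lemma sphereProb_eq_zero_iff {d : ℕ} {A : Set (Sph d)} :
    sphereProb d A = 0 ↔ surf d A = 0 := by
  rw [sphereProb_apply, mul_eq_zero, or_iff_right (ENNReal.inv_ne_zero.2 (measure_ne_top _ _))]

lemma sphereProb_div {d : ℕ} (hd : 1 ≤ d) (A B : Set (Sph d)) :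
    sphereProb d A / sphereProb d B = surf d A / surf d B := by
  rw [sphereProb_apply, sphereProb_apply]
  exact ENNReal.mul_div_mul_left _ _ (ENNReal.inv_ne_zero.2 (measure_ne_top _ _))
    (ENNReal.inv_ne_top.2 (surf_univ_ne_zero hd))

lemma nullMeasurableSet_surf {d : ℕ} {S : Set (Sph d)}
    (hS : NullMeasurableSet S (sphereProb d)) : NullMeasurableSet S (surf d) :=
  hS.mono_ac fun _ h ↦ sphereProb_eq_zero_iff.1 h

/-- Inherited from the invariance of Lebesgue measure under `x ↦ -x`, through cones; it makes the
symmetrized set null measurable. -/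
lemma quasiMeasurePreserving_neg_surf {d : ℕ} :
    Measure.QuasiMeasurePreserving (fun θ : Sph d ↦ -θ) (surf d) (surf d) := by
  refine ⟨continuous_neg.measurable, Measure.AbsolutelyContinuous.mk fun s hs h ↦ ?_⟩
  rw [Measure.map_apply continuous_neg.measurable hs]
  have hs' : MeasurableSet ((fun θ : Sph d ↦ -θ) ⁻¹' s) := continuous_neg.measurable hs
  rw [Measure.toSphere_apply' _ hs] at h
  rw [Measure.toSphere_apply' _ hs']
  rw [← h]
  congr 1
  rw [← Measure.measure_preimage_neg]
  congr 1
  ext x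
  simp only [Set.mem_smul, Set.mem_preimage, Set.mem_image]
  constructor
  · rintro ⟨a, ha, y, ⟨θ, hθ, rfl⟩, hx⟩
    refine ⟨a, ha, _, ⟨-θ, hθ, rfl⟩, ?_⟩
    simp [hx]
  · rintro ⟨a, ha, y, ⟨θ, hθ, rfl⟩, rfl⟩
    refine ⟨a, ha, _, ⟨-θ, by simpa using hθ, rfl⟩, ?_⟩
    simp

lemma nullMeasurableSet_symmetrized {d : ℕ} {S : Set (Sph d)}
    (hS : NullMeasurableSet S (sphereProb d)) : NullMeasurableSet (symmetrized S) (surf d) :=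
  (nullMeasurableSet_surf hS).union
    ((nullMeasurableSet_surf hS).preimage quasiMeasurePreserving_neg_surf)

lemma lowerDensity_eq_one_of_full {d : ℕ} (hd : 1 ≤ d) {A : Set (Sph d)}
    (h : sphereProb d Aᶜ = 0) (θ : Sph d) : lowerDensity A θ = 1 := by
  have h1 : (fun r : ℝ ↦ sphereProb d (A ∩ ball θ r) / sphereProb d (ball θ r)) =ᶠ[𝓝[>] 0]
      fun _ ↦ 1 := by
    filter_upwards [self_mem_nhdsWithin] with r hr
    have h2 : surf d (A ∩ ball θ r) = surf d (ball θ r) := by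
      exact Measure.measure_inter_eq_of_ae
        (measure_eq_zero_iff_ae_notMem.1 (sphereProb_eq_zero_iff.1 h) |>.mono fun x hx ↦ by
          simpa using hx)
    rw [sphereProb_div hd, h2]
    exact ENNReal.div_self (surf_ball_pos θ hr).ne' (measure_ne_top _ _)
  rw [lowerDensity, liminf_congr h1, liminf_const]

/-- If the complement were not null, one of its density points would contradict the hypothesis. The
density theorem concerns closed balls and `lowerDensity` open ones; the doubling property bridges
them. -/
lemma full_of_lowerDensity_eq_one {d : ℕ} (hd : 1 ≤ d) {A : Set (Sph d)}
    (hA : NullMeasurableSet A (surf d)) (h : ∀ θ, lowerDensity A θ = 1) :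
    sphereProb d Aᶜ = 0 := by
  rw [sphereProb_eq_zero_iff]
  by_contra hne
  have := isUnifLocDoublingMeasure_surf hd
  have hae := IsUnifLocDoublingMeasure.ae_tendsto_measure_inter_div (surf d) Aᶜ 0
  have hnb : (ae ((surf d).restrict Aᶜ)).NeBot := by
    rw [ae_neBot]; intro h0
    exact hne (Measure.restrict_eq_zero.1 h0)
  obtain ⟨θ, hθ⟩ := hae.exists
  have ht := hθ (l := 𝓝[>] (0 : ℝ)) (fun _ ↦ θ) id tendsto_id
    (Eventually.of_forall fun r ↦ by simp)
  set K : ℝ≥0∞ := ((d * 24 ^ d : ℕ) : ℝ≥0∞) with hK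
  have hK0 : K ≠ 0 := by rw [hK]; exact_mod_cast (by positivity)
  have hKt : K ≠ ⊤ := ENNReal.natCast_ne_top _
  -- Density above `1/2` in an open ball gives `A` more than the fraction `(2 * K)⁻¹` of the closed
  -- ball, so the complement filling more than the rest is a contradiction.
  have hlt : 1 - (2 * K)⁻¹ < 1 := ENNReal.sub_lt_self ENNReal.one_ne_top one_ne_zero
    (ENNReal.inv_ne_zero.2 (ENNReal.mul_ne_top ENNReal.ofNat_ne_top hKt))
  have e1 := ht.eventually (lt_mem_nhds hlt)
  have e2 : ∀ᶠ r in 𝓝[>] (0 : ℝ), (1 / 2 : ℝ≥0∞) <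
      sphereProb d (A ∩ ball θ r) / sphereProb d (ball θ r) := by
    refine eventually_lt_of_lt_liminf ?_
    have := h θ
    rw [lowerDensity] at this
    rw [this]
    exact ENNReal.half_lt_self one_ne_zero ENNReal.one_ne_top |>.trans_le' (by simp)
  obtain ⟨r, h1, h2, hr⟩ := (e1.and (e2.and
    (Ioc_mem_nhdsGT (show (0 : ℝ) < 1 / 4 by norm_num)))).exists
  simp only [id] at h1
  rw [sphereProb_div hd] at h2
  set M := surf d (closedBall θ r) with hM
  have hb0 := (surf_ball_pos θ hr.1).ne'
  have hMt : M ≠ ⊤ := measure_ne_top _ _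
  have hM0 : M ≠ 0 := fun h0 ↦ hb0 (measure_mono_null ball_subset_closedBall h0)
  have hdb : M ≤ K * surf d (ball θ r) :=
    (measure_mono (closedBall_subset_closedBall (by linarith [hr.1]))).trans
      (surf_closedBall_two_mul_le hd θ hr.1 hr.2)
  rw [ENNReal.lt_div_iff_mul_lt (Or.inl hb0) (Or.inl (measure_ne_top _ _))] at h2
  rw [ENNReal.lt_div_iff_mul_lt (Or.inl hM0) (Or.inl hMt)] at h1
  have hsum : surf d (A ∩ closedBall θ r) + surf d (Aᶜ ∩ closedBall θ r) = M := by
    rw [← Set.sdiff_eq_compl_inter, inter_comm, hM]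
    exact measure_inter_add_sdiff₀ _ hA
  have h3 : (2 * K)⁻¹ * M < surf d (A ∩ closedBall θ r) := by
    have h4 : (2 * K)⁻¹ * M ≤ 1 / 2 * surf d (ball θ r) := by
      rw [ENNReal.mul_inv (Or.inl two_ne_zero) (Or.inl ENNReal.ofNat_ne_top), one_div, mul_assoc]
      gcongr
      rw [← ENNReal.div_eq_inv_mul]
      exact ENNReal.div_le_of_le_mul' hdb
    exact (h4.trans_lt h2).trans_le (measure_mono (inter_subset_inter_right _ ball_subset_closedBall))
  have h5 : M < M := by
    calc M = ((2 * K)⁻¹ + (1 - (2 * K)⁻¹)) * M := by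
          rw [add_tsub_cancel_of_le, one_mul]
          rw [ENNReal.inv_le_one]
          have : (1 : ℝ≥0∞) ≤ K := by
            rw [hK]; exact_mod_cast Nat.one_le_iff_ne_zero.2 (by positivity)
          exact this.trans (le_mul_of_one_le_left zero_le one_le_two)
      _ = (2 * K)⁻¹ * M + (1 - (2 * K)⁻¹) * M := add_mul _ _ _
      _ < surf d (A ∩ closedBall θ r) + surf d (Aᶜ ∩ closedBall θ r) := ENNReal.add_lt_add h3 h1
      _ = M := hsum
  exact lt_irrefl _ h5

/-! ### Parity and observability from symmetric cones -/

lemma norm_sq_eq_integral {α : Type*} {m : MeasurableSpace α} {μ : Measure α} (f : Lp ℂ 2 μ) :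
    ‖f‖ ^ 2 = ∫ x, ‖f x‖ ^ 2 ∂μ := by
  have h : inner ℂ f f = ((∫ x, ‖f x‖ ^ 2 ∂μ : ℝ) : ℂ) := by
    rw [L2.inner_def, ← integral_complex_ofReal]
    refine integral_congr_ae (ae_of_all _ fun x ↦ ?_)
    simp only [inner_self_eq_norm_sq_to_K]
    push_cast; rfl
  rw [inner_self_eq_norm_sq_to_K] at h
  refine Complex.ofReal_injective ?_
  rw [← h]
  push_cast; rfl

lemma integrable_norm_sq {α : Type*} {m : MeasurableSpace α} {μ : Measure α} (f : Lp ℂ 2 μ) :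
    Integrable (fun x ↦ ‖f x‖ ^ 2) μ :=
  (memLp_two_iff_integrable_sq_norm (Lp.aestronglyMeasurable f)).1 (Lp.memLp f)

lemma continuous_setIntegral_norm_sq {d : ℕ} (ω : Set (Rd d)) :
    Continuous fun f : L2 d ↦ ∫ x in ω, ‖f x‖ ^ 2 := by
  have h : (fun f : L2 d ↦ ∫ x in ω, ‖f x‖ ^ 2) =
      fun f ↦ ‖LpToLpRestrictCLM (Rd d) ℂ ℂ volume 2 ω f‖ ^ 2 := by
    ext f
    rw [norm_sq_eq_integral]
    refine integral_congr_ae ?_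
    filter_upwards [LpToLpRestrictCLM_coeFn ℂ ω f] with x hx
    rw [hx]
  rw [h]
  fun_prop

lemma continuous_observation {d : ℕ} {ν : ℝ} (hν : 0 < ν) (ω : Set (Rd d)) (u : L2 d) :
    Continuous fun t ↦ ∫ x in ω, ‖propagator d ν t u x‖ ^ 2 :=
  (continuous_setIntegral_norm_sq ω).comp ((isSchrodingerGroup_propagator hν).continuous u)

/-- The reflection `u ↦ u(-x)` on `L²`. -/
noncomputable def reflection (d : ℕ) : L2 d →L[ℂ] L2 d :=
  (Lp.compMeasurePreservingₗᵢ ℂ (fun x : Rd d ↦ -x)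
    (Measure.measurePreserving_neg volume)).toContinuousLinearMap

lemma coeFn_reflection {d : ℕ} (u : L2 d) : reflection d u =ᵐ[volume] fun x ↦ u (-x) :=
  Lp.coeFn_compMeasurePreserving u (Measure.measurePreserving_neg volume)

/-- At this time the parameter is multiplied by `-1`, which for a coherent state is the same as
reflecting `x`. -/
lemma propagator_half_period {d : ℕ} {ν : ℝ} (hν : 0 < ν) :
    propagator d ν (Real.pi / ν) = groundPhase d ν (Real.pi / ν) • reflection d := by
  refine clm_ext_cohLp hν fun z ↦ ?_
  rw [propagator_cohLp, evolvedCoh, _root_.smul_apply]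
  congr 1
  refine Lp.ext ?_
  have hrot : ∀ i, rotate ν (Real.pi / ν) z i = -z i := by
    intro i
    have hν' : (ν : ℂ) ≠ 0 := by exact_mod_cast hν.ne'
    have h1 : -((ν : ℂ) * ((Real.pi / ν : ℝ) : ℂ)) * Complex.I = -(Real.pi * Complex.I) := by
      push_cast; field_simp
    rw [rotate, h1, Complex.exp_neg, Complex.exp_pi_mul_I]
    norm_num
  have hneg : ∀ᵐ x : Rd d, cohLp hν z (-x) = coherent ν z (-x) :=
    (Measure.measurePreserving_neg (volume : Measure (Rd d))).quasiMeasurePreserving.ae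
      (coeFn_cohLp hν z)
  filter_upwards [coeFn_cohLp hν (rotate ν (Real.pi / ν) z), coeFn_reflection (cohLp hν z), hneg]
    with x h1 h2 h3
  rw [h1, h2, h3, coherent, coherent]
  simp [hrot]

lemma observation_add_half_period {d : ℕ} {ν : ℝ} (hν : 0 < ν) (ω : Set (Rd d)) (u : L2 d)
    (t : ℝ) :
    ∫ x in ω, ‖propagator d ν (t + Real.pi / ν) u x‖ ^ 2 =
      ∫ x in (fun x ↦ -x) ⁻¹' ω, ‖propagator d ν t u x‖ ^ 2 := by
  have h1 : propagator d ν (t + Real.pi / ν) u =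
      groundPhase d ν (Real.pi / ν) • reflection d (propagator d ν t u) := by
    rw [add_comm, (isSchrodingerGroup_propagator hν).add, propagator_half_period hν]
    rfl
  set w := propagator d ν t u
  have h2 : ∫ x in ω, ‖propagator d ν (t + Real.pi / ν) u x‖ ^ 2 = ∫ x in ω, ‖w (-x)‖ ^ 2 := by
    refine integral_congr_ae (ae_restrict_of_ae ?_)
    rw [h1]
    filter_upwards [Lp.coeFn_smul (groundPhase d ν (Real.pi / ν)) (reflection d w),
      coeFn_reflection w] with x e1 e2
    rw [e1, Pi.smul_apply, e2, norm_smul, norm_groundPhase, one_mul]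
  rw [h2]
  have h3 := (Measure.measurePreserving_neg (volume : Measure (Rd d))).setIntegral_preimage_emb
    (MeasurableEquiv.neg (Rd d)).measurableEmbedding (fun x ↦ ‖w x‖ ^ 2) ((fun x ↦ -x) ⁻¹' ω)
  rw [← h3]
  congr 2
  ext x; simp

lemma norm_sq_le_observation_add {d : ℕ} {ν : ℝ} (hν : 0 < ν) {ω : Set (Rd d)}
    (hω : volume (ω ∪ (fun x ↦ -x) ⁻¹' ω)ᶜ = 0) (u : L2 d) (t : ℝ) :
    ‖u‖ ^ 2 ≤ (∫ x in ω, ‖propagator d ν t u x‖ ^ 2) +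
      ∫ x in ω, ‖propagator d ν (t + Real.pi / ν) u x‖ ^ 2 := by
  rw [observation_add_half_period hν, ← (isSchrodingerGroup_propagator hν).norm_apply t u,
    norm_sq_eq_integral]
  have hi := integrable_norm_sq (propagator d ν t u)
  rw [← integral_add_measure hi.restrict hi.restrict]
  have h1 : (volume : Measure (Rd d)) = volume.restrict (ω ∪ (fun x ↦ -x) ⁻¹' ω) :=
    (Measure.restrict_eq_self_of_ae_mem (measure_eq_zero_iff_ae_notMem.1 hω |>.mono fun x hx ↦
      not_not.1 hx)).symm
  refine integral_mono_measure ?_ (ae_of_all _ fun x ↦ by positivity)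
    (hi.restrict.add_measure hi.restrict)
  conv_lhs => rw [h1]
  exact Measure.restrict_union_le _ _

/-- With `h = π / (2ν)`, the windows `[0, h]` and `[2h, 3h]` are half a period apart, so together
they capture at least `h ‖u‖²`; the middle window is dropped. The length `3h` is below the full
period `4h`. -/
lemma observable_of_symmetric_full {d : ℕ} {ν : ℝ} (hν : 0 < ν) {ω : Set (Rd d)}
    (hω : volume (ω ∪ (fun x ↦ -x) ⁻¹' ω)ᶜ = 0) :
    Observable ν ω (3 * Real.pi / (2 * ν)) := by
  have hπ := Real.pi_pos
  refine ⟨2 * ν / Real.pi, by positivity, fun u ↦ ?_⟩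
  set F : ℝ → ℝ := fun t ↦ ∫ x in ω, ‖propagator d ν t u x‖ ^ 2 with hF
  have hFc : Continuous F := continuous_observation hν ω u
  have hF0 : ∀ t, 0 ≤ F t := fun t ↦ integral_nonneg fun x ↦ by positivity
  set h := Real.pi / (2 * ν) with hh
  have hhp : 0 < h := by positivity
  have hp : Real.pi / ν = 2 * h := by rw [hh]; field_simp
  have hT : 3 * Real.pi / (2 * ν) = 3 * h := by rw [hh]; ring
  have hii : ∀ a b, IntervalIntegrable F volume a b := fun a b ↦ hFc.intervalIntegrable a b
  have h1 : ∫ t in (0 : ℝ)..(3 * h), F t = (∫ t in (0 : ℝ)..h, F t) +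
      (∫ t in h..(2 * h), F t) + ∫ t in (2 * h)..(3 * h), F t := by
    rw [intervalIntegral.integral_add_adjacent_intervals (hii _ _) (hii _ _),
      intervalIntegral.integral_add_adjacent_intervals (hii _ _) (hii _ _)]
  have h2 : ∫ t in (2 * h)..(3 * h), F t = ∫ t in (0 : ℝ)..h, F (t + Real.pi / ν) := by
    rw [intervalIntegral.integral_comp_add_right, hp]
    ring_nf
  have h3 : 0 ≤ ∫ t in h..(2 * h), F t :=
    intervalIntegral.integral_nonneg (by linarith) fun t _ ↦ hF0 t
  have hFc' : Continuous fun t ↦ F (t + Real.pi / ν) := by fun_prop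
  have h4 : h * ‖u‖ ^ 2 ≤ (∫ t in (0 : ℝ)..h, F t) + ∫ t in (0 : ℝ)..h, F (t + Real.pi / ν) := by
    rw [← intervalIntegral.integral_add (hii _ _) (hFc'.intervalIntegrable _ _)]
    have h5 : ∫ _ in (0 : ℝ)..h, ‖u‖ ^ 2 = h * ‖u‖ ^ 2 := by simp
    rw [← h5]
    exact intervalIntegral.integral_mono_on hhp.le intervalIntegrable_const
      ((hii _ _).add (hFc'.intervalIntegrable _ _))
      fun t _ ↦ norm_sq_le_observation_add hν hω u t
  have h6 : h * ‖u‖ ^ 2 ≤ ∫ t in (0 : ℝ)..(3 * h), F t := by rw [h1, h2]; linarith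
  rw [hT]
  have h7 : 2 * ν / Real.pi * h = 1 := by rw [hh]; field_simp
  calc ‖u‖ ^ 2 = 2 * ν / Real.pi * (h * ‖u‖ ^ 2) := by rw [← mul_assoc, h7, one_mul]
    _ ≤ _ := by gcongr

lemma volume_compl_cone_union_neg {d : ℕ} {S : Set (Sph d)} (hd : 1 ≤ d)
    (h : sphereProb d (symmetrized S)ᶜ = 0) :
    volume (cone S ∪ (fun x ↦ -x) ⁻¹' cone S)ᶜ = 0 := by
  -- Positive dimension is what makes the origin a null set.
  have : Nonempty (Fin d) := ⟨⟨0, hd⟩⟩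
  have h1 := volume_cone_eq_zero (sphereProb_eq_zero_iff.1 h)
  refine measure_mono_null (t := cone (symmetrized S)ᶜ ∪ {0}) (fun x hx ↦ ?_)
    (measure_union_null h1 (measure_singleton _))
  by_cases hx0 : x = 0
  · exact Or.inr hx0
  refine Or.inl ⟨hx0, ⟨‖x‖⁻¹ • x, by simp [norm_smul, hx0]⟩, fun hmem ↦ hx ?_, rfl⟩
  rcases hmem with hm | hm
  · exact Or.inl ⟨hx0, _, hm, rfl⟩
  · exact Or.inr ⟨neg_ne_zero.2 hx0, _, hm, by simp⟩

/-! ### Coherent states on trajectories through the origin -/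

/-- The modulus of an evolving coherent state started at rest at the point `R θ`. -/
lemma norm_coherent_rotate_sq {d : ℕ} {ν : ℝ} (hν : 0 < ν) (θ : Sph d) (R t : ℝ) (x : Rd d) :
    ‖coherent ν (rotate ν t fun i ↦ ((ν * R * (θ : Rd d) i : ℝ) : ℂ)) x‖ ^ 2 =
      Real.exp (ν * R ^ 2 / 2) *
        Real.exp (-ν * ‖x - (R * Real.cos (ν * t)) • (θ : Rd d)‖ ^ 2) := by
  set z : Fin d → ℂ := fun i ↦ ((ν * R * (θ : Rd d) i : ℝ) : ℂ) with hz
  have hθ : ‖(θ : Rd d)‖ = 1 := by simp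
  have hpair : ∑ i, z i * (x i : ℂ) = ((ν * R * inner ℝ x (θ : Rd d) : ℝ) : ℂ) := by
    rw [PiLp.inner_apply, Finset.mul_sum]
    push_cast
    refine Finset.sum_congr rfl fun i _ ↦ ?_
    simp only [hz]
    push_cast
    simp
    ring
  have hsq : ∑ i, z i ^ 2 = (((ν * R) ^ 2 : ℝ) : ℂ) := by
    have h1 : ∑ i, (θ : Rd d) i ^ 2 = 1 := by
      have := EuclideanSpace.norm_sq_eq (θ : Rd d)
      rw [hθ] at this
      simpa using this.symm
    have h2 : ∑ i, z i ^ 2 = (((ν * R) ^ 2 * ∑ i, (θ : Rd d) i ^ 2 : ℝ) : ℂ) := by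
      rw [Finset.mul_sum]; push_cast
      refine Finset.sum_congr rfl fun i _ ↦ ?_
      simp only [hz]; push_cast; ring
    rw [h2, h1, mul_one]
  have hre1 : (Complex.exp (-(ν * t) * Complex.I)).re = Real.cos (ν * t) := by
    have : (-((ν : ℂ) * t) * Complex.I) = ((-(ν * t) : ℝ) : ℂ) * Complex.I := by push_cast; ring
    rw [this, Complex.exp_ofReal_mul_I_re, Real.cos_neg]
  -- The double-angle formula turns the term in `z·z` into the `cos²` needed to complete the square
  -- around `R cos (νt) θ`.
  have hre2 : (Complex.exp (-(ν * t) * Complex.I) ^ 2).re = 2 * Real.cos (ν * t) ^ 2 - 1 := by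
    rw [← Complex.exp_nat_mul]
    have : ((2 : ℕ) : ℂ) * (-((ν : ℂ) * t) * Complex.I) = ((-(2 * (ν * t)) : ℝ) : ℂ) * Complex.I := by
      push_cast; ring
    rw [this, Complex.exp_ofReal_mul_I_re, Real.cos_neg, Real.cos_two_mul]
  have h0 : (-((ν : ℂ) / 2) * (‖x‖ : ℂ) ^ 2) = ((-(ν / 2) * ‖x‖ ^ 2 : ℝ) : ℂ) := by push_cast; ring
  have h4 : (4 * (ν : ℂ)) = ((4 * ν : ℝ) : ℂ) := by push_cast; ring
  rw [coherent, Complex.norm_exp, ← Real.exp_nat_mul, ← Real.exp_add]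
  congr 1
  rw [pairing_rotate, sum_sq_rotate, hpair, hsq, h0, h4, Complex.sub_re, Complex.add_re,
    Complex.div_ofReal_re, Complex.re_mul_ofReal, Complex.re_mul_ofReal, hre1, hre2,
    Complex.ofReal_re, norm_sub_sq_real, norm_smul, hθ, inner_smul_right, Real.norm_eq_abs, mul_one,
    sq_abs]
  push_cast
  field_simp
  ring

lemma propagator_cohLp_norm_sq {d : ℕ} {ν : ℝ} (hν : 0 < ν) (θ : Sph d) (R t : ℝ) :
    ∀ᵐ x, ‖propagator d ν t (cohLp hν fun i ↦ ((ν * R * (θ : Rd d) i : ℝ) : ℂ)) x‖ ^ 2 =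
      Real.exp (ν * R ^ 2 / 2) *
        Real.exp (-ν * ‖x - (R * Real.cos (ν * t)) • (θ : Rd d)‖ ^ 2) := by
  set z : Fin d → ℂ := fun i ↦ ((ν * R * (θ : Rd d) i : ℝ) : ℂ) with hz
  rw [propagator_cohLp, evolvedCoh]
  filter_upwards [Lp.coeFn_smul (groundPhase d ν t) (cohLp hν (rotate ν t z)),
    coeFn_cohLp hν (rotate ν t z)] with x e1 e2
  rw [e1, Pi.smul_apply, e2, norm_smul, norm_groundPhase, one_mul, hz,
    norm_coherent_rotate_sq hν]

lemma integral_exp_neg_mul_sq_norm_sub {d : ℕ} (b : ℝ) (c : Rd d) :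
    ∫ x : Rd d, Real.exp (-b * ‖x - c‖ ^ 2) = ∫ x : Rd d, Real.exp (-b * ‖x‖ ^ 2) :=
  integral_sub_right_eq_self (fun x : Rd d ↦ Real.exp (-b * ‖x‖ ^ 2)) c

lemma integrable_exp_neg_mul_sq_norm_sub {d : ℕ} {b : ℝ} (hb : 0 < b) (c : Rd d) :
    Integrable fun x : Rd d ↦ Real.exp (-b * ‖x - c‖ ^ 2) :=
  (integrable_exp_neg_mul_sq_norm hb).comp_sub_right c

lemma integral_exp_neg_mul_sq_norm_pos {d : ℕ} {b : ℝ} (hb : 0 < b) :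
    0 < ∫ x : Rd d, Real.exp (-b * ‖x‖ ^ 2) := by
  rw [integral_pos_iff_support_of_nonneg (fun x ↦ (Real.exp_pos _).le)
    (integrable_exp_neg_mul_sq_norm hb)]
  have : Function.support (fun x : Rd d ↦ Real.exp (-b * ‖x‖ ^ 2)) = univ := by
    ext x; simp
  rw [this]
  exact NeZero.pos _

/-- The observability inequality tested on coherent states through the origin. -/
lemma gaussian_observability {d : ℕ} {ν : ℝ} (hν : 0 < ν) {ω : Set (Rd d)} {T C : ℝ}
    (h : ∀ u : L2 d, ‖u‖ ^ 2 ≤ C * ∫ t in (0 : ℝ)..T, ∫ x in ω, ‖propagator d ν t u x‖ ^ 2)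
    (θ : Sph d) (R : ℝ) :
    (Continuous fun t ↦ ∫ x in ω, Real.exp (-ν * ‖x - (R * Real.cos (ν * t)) • (θ : Rd d)‖ ^ 2)) ∧
    ∫ x : Rd d, Real.exp (-ν * ‖x‖ ^ 2) ≤ C * ∫ t in (0 : ℝ)..T,
      ∫ x in ω, Real.exp (-ν * ‖x - (R * Real.cos (ν * t)) • (θ : Rd d)‖ ^ 2) := by
  set z : Fin d → ℂ := fun i ↦ ((ν * R * (θ : Rd d) i : ℝ) : ℂ) with hz
  have hE := Real.exp_pos (ν * R ^ 2 / 2)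
  have h1 : ∀ t, ∫ x in ω, ‖propagator d ν t (cohLp hν z) x‖ ^ 2 = Real.exp (ν * R ^ 2 / 2) *
      ∫ x in ω, Real.exp (-ν * ‖x - (R * Real.cos (ν * t)) • (θ : Rd d)‖ ^ 2) := by
    intro t
    rw [← integral_const_mul]
    exact integral_congr_ae (ae_restrict_of_ae (propagator_cohLp_norm_sq hν θ R t))
  have h2 : ‖cohLp hν z‖ ^ 2 = Real.exp (ν * R ^ 2 / 2) * ∫ x : Rd d, Real.exp (-ν * ‖x‖ ^ 2) := by
    rw [← (isSchrodingerGroup_propagator hν).norm_apply 0, norm_sq_eq_integral,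
      ← integral_exp_neg_mul_sq_norm_sub ν ((R * Real.cos (ν * 0)) • (θ : Rd d)),
      ← integral_const_mul]
    exact integral_congr_ae (propagator_cohLp_norm_sq hν θ R 0)
  constructor
  · have hc := continuous_observation hν ω (cohLp hν z)
    simp only [h1] at hc
    have := hc.const_mul (Real.exp (ν * R ^ 2 / 2))⁻¹
    simpa [hE.ne'] using this
  · have h3 := h (cohLp hν z)
    simp only [h1, intervalIntegral.integral_const_mul, h2] at h3
    refine le_of_mul_le_mul_left (h3.trans_eq ?_) hE
    ring

/-! ### Gaussian mass of a cone near a point -/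

/-- The Gaussian is at most one inside the ball; outside, half of the exponent gives smallness and
the other half integrability. -/
lemma setIntegral_gaussian_le {d : ℕ} {ν : ℝ} (hν : 0 < ν) (ω : Set (Rd d)) (c : Rd d) {A : ℝ}
    (hA : 0 < A) :
    ∫ x in ω, Real.exp (-ν * ‖x - c‖ ^ 2) ≤ volume.real (ω ∩ ball c A) +
      Real.exp (-(ν / 2) * A ^ 2) * ∫ x : Rd d, Real.exp (-(ν / 2) * ‖x‖ ^ 2) := by
  have hν2 : 0 < ν / 2 := by positivity
  have hb : ∀ x, Real.exp (-ν * ‖x - c‖ ^ 2) ≤ (ball c A).indicator 1 x +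
      Real.exp (-(ν / 2) * A ^ 2) * Real.exp (-(ν / 2) * ‖x - c‖ ^ 2) := by
    intro x
    by_cases hx : x ∈ ball c A
    · rw [indicator_of_mem hx]
      have : Real.exp (-ν * ‖x - c‖ ^ 2) ≤ 1 := Real.exp_le_one_iff.2 (by
        nlinarith [sq_nonneg ‖x - c‖])
      have : 0 ≤ Real.exp (-(ν / 2) * A ^ 2) * Real.exp (-(ν / 2) * ‖x - c‖ ^ 2) := by positivity
      simp only [Pi.one_apply]
      linarith
    · rw [indicator_of_notMem hx, zero_add, ← Real.exp_add, Real.exp_le_exp]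
      rw [mem_ball, not_lt, dist_eq_norm] at hx
      have : A ^ 2 ≤ ‖x - c‖ ^ 2 := by gcongr
      nlinarith
  have hi1 := integrable_exp_neg_mul_sq_norm_sub hν c
  have hi2 := (integrable_exp_neg_mul_sq_norm_sub hν2 c).const_mul (Real.exp (-(ν / 2) * A ^ 2))
  have hi3 : Integrable ((ball c A).indicator (1 : Rd d → ℝ)) :=
    (integrable_indicator_iff measurableSet_ball).2
      (integrableOn_const measure_ball_lt_top.ne)
  calc ∫ x in ω, Real.exp (-ν * ‖x - c‖ ^ 2)
      ≤ ∫ x in ω, ((ball c A).indicator 1 x +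
        Real.exp (-(ν / 2) * A ^ 2) * Real.exp (-(ν / 2) * ‖x - c‖ ^ 2)) :=
        integral_mono hi1.restrict (hi3.add hi2).restrict hb
    _ = volume.real (ω ∩ ball c A) +
        ∫ x in ω, Real.exp (-(ν / 2) * A ^ 2) * Real.exp (-(ν / 2) * ‖x - c‖ ^ 2) := by
        rw [integral_add hi3.restrict hi2.restrict, integral_indicator_one measurableSet_ball,
          measureReal_restrict_apply measurableSet_ball, inter_comm]
    _ ≤ volume.real (ω ∩ ball c A) +
        ∫ x, Real.exp (-(ν / 2) * A ^ 2) * Real.exp (-(ν / 2) * ‖x - c‖ ^ 2) := by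
        exact add_le_add le_rfl
          (setIntegral_le_integral hi2 (ae_of_all _ fun x ↦ by positivity))
    _ = _ := by rw [integral_const_mul, integral_exp_neg_mul_sq_norm_sub]

lemma setIntegral_gaussian_le_integral {d : ℕ} {ν : ℝ} (hν : 0 < ν) (ω : Set (Rd d)) (c : Rd d) :
    ∫ x in ω, Real.exp (-ν * ‖x - c‖ ^ 2) ≤ ∫ x : Rd d, Real.exp (-ν * ‖x‖ ^ 2) := by
  rw [← integral_exp_neg_mul_sq_norm_sub ν c]
  exact setIntegral_le_integral (integrable_exp_neg_mul_sq_norm_sub hν c)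
    (ae_of_all _ fun x ↦ (Real.exp_pos _).le)

lemma pow_sub_pow_le_mul {a b : ℝ} (ha : 0 ≤ a) (hab : a ≤ b) (n : ℕ) :
    b ^ (n + 1) - a ^ (n + 1) ≤ (n + 1) * ((b - a) * b ^ n) := by
  induction n with
  | zero => simp
  | succ n ih =>
    have hb : 0 ≤ b := ha.trans hab
    have h1 : a ^ (n + 1) ≤ b ^ (n + 1) := by gcongr
    have h2 : (b - a) * a ^ (n + 1) ≤ (b - a) * b ^ (n + 1) :=
      mul_le_mul_of_nonneg_left h1 (by linarith)
    have h3 := mul_le_mul_of_nonneg_left ih hb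
    calc b ^ (n + 1 + 1) - a ^ (n + 1 + 1)
        = b * (b ^ (n + 1) - a ^ (n + 1)) + (b - a) * a ^ (n + 1) := by ring
      _ ≤ b * ((n + 1) * ((b - a) * b ^ n)) + (b - a) * b ^ (n + 1) := add_le_add h3 h2
      _ = _ := by push_cast; ring

lemma cone_mono {d : ℕ} {Q Q' : Set (Sph d)} (h : Q ⊆ Q') : cone Q ⊆ cone Q' :=
  fun _ hx ↦ ⟨hx.1, image_mono h hx.2⟩

lemma mem_cone_symmetrized_inter_ball {d : ℕ} {S : Set (Sph d)} {θ : Sph d} {x : Rd d}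
    {ρ A r : ℝ} (hρ : 0 < ρ) (hr : 2 * A ≤ r * ρ)
    (hx : x ∈ cone S ∪ (fun x ↦ -x) ⁻¹' cone S) (hxb : ‖x - ρ • (θ : Rd d)‖ < A) :
    x ∈ cone (symmetrized S ∩ ball θ r) ∩ {x | ρ - A ≤ ‖x‖ ∧ ‖x‖ < ρ + A} := by
  have hθ : ‖(θ : Rd d)‖ = 1 := by simp
  have h1 := abs_norm_sub_norm_le x (ρ • (θ : Rd d))
  rw [norm_smul, hθ, mul_one, Real.norm_of_nonneg hρ.le] at h1
  have h2 := abs_lt.1 (h1.trans_lt hxb)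
  have hx0 : x ≠ 0 := by
    rcases hx with hx | hx
    · exact hx.1
    · exact neg_ne_zero.1 hx.1
  have hdir : ‖‖x‖⁻¹ • x - θ‖ < r := by
    refine (norm_inv_norm_smul_sub_le hθ hx0 hρ).trans_lt ?_
    rw [div_lt_iff₀ hρ]
    linarith
  refine ⟨⟨hx0, ⟨‖x‖⁻¹ • x, by simp [norm_smul, hx0]⟩, ⟨?_, ?_⟩, rfl⟩,
    by linarith [h2.1], by linarith [h2.2]⟩
  · rcases hx with ⟨_, η, hη, hηx⟩ | ⟨_, η, hη, hηx⟩
    · left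
      convert hη
      exact hηx.symm
    · right
      change -_ ∈ S
      convert hη
      refine Subtype.ext ?_
      rw [hηx]; simp
  · rwa [mem_ball, Subtype.dist_eq, dist_eq_norm]

/-- Seen from the origin, the ball lies within the cap of radius `r` around `±θ`, with the sign of
`κ`. Negative `κ` is reduced to positive by reflection, which is why the symmetrized set appears. -/
lemma volume_cone_inter_ball_le {d : ℕ} (hd : 1 ≤ d) {S : Set (Sph d)} {θ : Sph d}
    {κ A r : ℝ} (hA0 : 0 < A) (hA : 2 * A ≤ |κ|) (hr : 2 * A ≤ r * |κ|) :
    volume.real (cone S ∩ ball (κ • (θ : Rd d)) A) ≤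
      (surf d).real (symmetrized S ∩ ball θ r) * (2 * A * (2 * |κ|) ^ (d - 1)) := by
  set ρ := |κ| with hρ
  have hρ0 : 0 < ρ := by linarith
  set Q := symmetrized S ∩ ball θ r with hQ
  set Q' := toMeasurable (surf d) Q with hQ'
  have hv := volume_cone_inter_shell hd (measurableSet_toMeasurable (surf d) Q) (a := ρ - A)
    (b := ρ + A) (by linarith) (by linarith)
  rw [measure_toMeasurable] at hv
  have hmem : ∀ x : Rd d, x ∈ cone S ∪ (fun x ↦ -x) ⁻¹' cone S → ‖x - ρ • (θ : Rd d)‖ < A →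
      x ∈ cone Q' ∩ {x | ρ - A ≤ ‖x‖ ∧ ‖x‖ < ρ + A} := fun x hx hxb ↦ by
    have := mem_cone_symmetrized_inter_ball hρ0 hr hx hxb
    exact ⟨cone_mono (subset_toMeasurable _ _) this.1, this.2⟩
  have hle : volume (cone S ∩ ball (κ • (θ : Rd d)) A) ≤
      volume (cone Q' ∩ {x | ρ - A ≤ ‖x‖ ∧ ‖x‖ < ρ + A}) := by
    rcases le_total 0 κ with hκ | hκ
    · refine measure_mono fun x hx ↦ hmem x (Or.inl hx.1) ?_
      have := hx.2
      rwa [mem_ball, dist_eq_norm, ← abs_of_nonneg hκ] at this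
    · rw [← Measure.measure_preimage_neg]
      refine measure_mono fun x hx ↦ hmem x (Or.inr hx.1) ?_
      have := hx.2
      rw [mem_ball, dist_eq_norm] at this
      rw [← norm_neg, hρ, abs_of_nonpos hκ]
      have hneg : -(x - -κ • (θ : Rd d)) = -x - κ • (θ : Rd d) := by rw [neg_smul]; abel
      rwa [hneg]
  rw [hv] at hle
  have h' := ENNReal.toReal_mono (ENNReal.mul_ne_top (measure_ne_top _ _) ENNReal.ofReal_ne_top) hle
  have hd' : (0 : ℝ) < d := by exact_mod_cast hd
  have hpow : (ρ - A) ^ d ≤ (ρ + A) ^ d := by gcongr <;> linarith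
  rw [ENNReal.toReal_mul, ENNReal.toReal_ofReal (div_nonneg (by linarith) hd'.le)] at h'
  refine h'.trans ?_
  rw [← measureReal_def]
  gcongr
  rw [div_le_iff₀ hd']
  obtain ⟨n, rfl⟩ : ∃ n, d = n + 1 := ⟨d - 1, by omega⟩
  refine (pow_sub_pow_le_mul (by linarith) (by linarith) n).trans ?_
  have h3 : (ρ + A) ^ n ≤ (2 * ρ) ^ n := by gcongr; linarith
  have h4 : ρ + A - (ρ - A) = 2 * A := by ring
  rw [h4, Nat.add_sub_cancel]
  push_cast
  calc ((n : ℝ) + 1) * (2 * A * (ρ + A) ^ n) ≤ ((n : ℝ) + 1) * (2 * A * (2 * ρ) ^ n) := by gcongr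
    _ = _ := by ring

/-- If the density of the symmetrized set at scale `r` is at most `η`, then coherent states of size
`R = 2 A / (ε r)` see little of the cone, except when they are close to the origin. -/
lemma setIntegral_gaussian_cone_le {d : ℕ} (hd : 1 ≤ d) {ν : ℝ} (hν : 0 < ν) {S : Set (Sph d)}
    {θ : Sph d} {A r ε η κ : ℝ} (hA : 0 < A) (hr : 0 < r) (hr2 : r ≤ 1 / 2) (hε : 0 < ε)
    (hη : 0 < η)
    (hdens : (surf d).real (symmetrized S ∩ ball θ r) ≤ η * (surf d).real (ball θ r))
    (h1 : 2 * A / r ≤ |κ|) (h2 : |κ| ≤ 2 * A / (ε * r)) :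
    ∫ x in cone S, Real.exp (-ν * ‖x - κ • (θ : Rd d)‖ ^ 2) ≤
      η * (d * (volume.real (ball (0 : Rd d) 1) * 3 ^ d) * (2 * A * (4 * A / ε) ^ (d - 1))) +
      Real.exp (-(ν / 2) * A ^ 2) * ∫ x : Rd d, Real.exp (-(ν / 2) * ‖x‖ ^ 2) := by
  refine (setIntegral_gaussian_le hν _ _ hA).trans ?_
  gcongr
  have h1' : 2 * A ≤ r * |κ| := by
    rw [div_le_iff₀ hr] at h1; linarith
  have h1'' : 2 * A ≤ |κ| := by nlinarith [abs_nonneg κ]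
  refine (volume_cone_inter_ball_le hd hA h1'' h1').trans ?_
  have hcap : (surf d).real (ball θ r) ≤
      d * (volume.real (ball (0 : Rd d) 1) * 3 ^ d) * r ^ (d - 1) := by
    have h3 := mul_surf_closedBall_le hd θ hr hr2
    have h4 : (surf d).real (ball θ r) ≤ (surf d).real (closedBall θ r) :=
      measureReal_mono ball_subset_closedBall
    refine h4.trans (le_of_mul_le_mul_left (h3.trans_eq ?_) hr)
    have h5 : r ^ d = r * r ^ (d - 1) := by rw [← pow_succ', Nat.sub_add_cancel hd]
    rw [mul_pow, h5]; ring
  calc (surf d).real (symmetrized S ∩ ball θ r) * (2 * A * (2 * |κ|) ^ (d - 1))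
      ≤ (η * (d * (volume.real (ball (0 : Rd d) 1) * 3 ^ d) * r ^ (d - 1))) *
        (2 * A * (2 * (2 * A / (ε * r))) ^ (d - 1)) := by
        gcongr
        exact hdens.trans (by gcongr)
    -- The factor `r ^ (d - 1)` from the cap cancels the growth of `|κ| ^ (d - 1)`, so the bound
    -- does not depend on `r`.
    _ = η * (d * (volume.real (ball (0 : Rd d) 1) * 3 ^ d) *
        (2 * A * (r * (2 * (2 * A / (ε * r)))) ^ (d - 1))) := by rw [mul_pow r]; ring
    _ = _ := by
        have : r * (2 * (2 * A / (ε * r))) = 4 * A / ε := by field_simp; ring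
        rw [this]

/-! ### The necessary condition -/

/-- Continuity from above: these sets decrease to the zeros of the cosine, which are countable. They
are the times at which the trajectory may be too close to the origin. -/
lemma exists_volume_abs_cos_lt_le {ν : ℝ} (hν : 0 < ν) (T : ℝ) {κ : ℝ} (hκ : 0 < κ) :
    ∃ ε : ℝ, 0 < ε ∧ volume.real ({t | |Real.cos (ν * t)| < ε} ∩ Ioc 0 T) ≤ κ := by
  set s : ℕ → Set ℝ := fun n ↦ {t | |Real.cos (ν * t)| < 1 / (n + 1)} ∩ Ioc 0 T with hs
  have hm : ∀ n, MeasurableSet (s n) := fun n ↦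
    (measurableSet_lt (by fun_prop) measurable_const).inter measurableSet_Ioc
  have hfin : ∀ n, volume (s n) ≠ ⊤ := fun n ↦
    ((measure_mono inter_subset_right).trans_lt measure_Ioc_lt_top).ne
  have hanti : Antitone s := by
    rintro m n hmn t ⟨ht, hT⟩
    refine ⟨?_, hT⟩
    rw [mem_ofPred_eq] at ht ⊢
    exact ht.trans_le (Nat.one_div_le_one_div hmn)
  have h0 : volume (⋂ n, s n) = 0 := by
    have hsub : (⋂ n, s n) ⊆ range fun k : ℤ ↦ (2 * (k : ℝ) + 1) * Real.pi / 2 / ν := by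
      intro t ht
      rw [mem_iInter] at ht
      have hc : Real.cos (ν * t) = 0 := by
        by_contra hne
        obtain ⟨n, hn⟩ := exists_nat_one_div_lt (abs_pos.2 hne)
        exact lt_asymm hn (ht n).1
      obtain ⟨k, hk⟩ := Real.cos_eq_zero_iff.1 hc
      exact ⟨k, by simp only [← hk]; field_simp⟩
    exact ((countable_range _).mono hsub).measure_zero _
  have ht := tendsto_measure_iInter_atTop (fun n ↦ (hm n).nullMeasurableSet) hanti ⟨0, hfin 0⟩
  rw [h0] at ht
  obtain ⟨n, hn⟩ := (ht.eventually (gt_mem_nhds (ENNReal.ofReal_pos.2 hκ))).exists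
  exact ⟨1 / (n + 1), by positivity, ENNReal.toReal_le_of_le_ofReal hκ.le hn.le⟩

/-- If the density were below `η` at some small scale, the observed mass, multiplied by `C`, would
be at most `m/4` from the Gaussian tail, `m/4` from the cone near the centre and `m/4` from the
times near the origin: `3m/4` in all, less than the total mass `m`. -/
lemma lowerDensity_lower_bound_of_observable {d : ℕ} (hd : 1 ≤ d) {ν : ℝ} (hν : 0 < ν)
    {S : Set (Sph d)} {T : ℝ} (hT : 0 < T) (hobs : Observable ν (cone S) T) :
    0 < ⨅ θ : Sph d, lowerDensity (symmetrized S) θ := by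
  obtain ⟨C, hC, h⟩ := hobs
  set m := ∫ x : Rd d, Real.exp (-ν * ‖x‖ ^ 2) with hm
  have hm0 : 0 < m := integral_exp_neg_mul_sq_norm_pos hν
  set m' := ∫ x : Rd d, Real.exp (-(ν / 2) * ‖x‖ ^ 2) with hm'
  have hm'0 : 0 < m' := integral_exp_neg_mul_sq_norm_pos (by positivity)
  obtain ⟨ε, hε, hεT⟩ := exists_volume_abs_cos_lt_le hν T (κ := 1 / (4 * C)) (by positivity)
  obtain ⟨A, hA, hAm⟩ : ∃ A : ℝ, 0 < A ∧ Real.exp (-(ν / 2) * A ^ 2) * m' ≤ m / (4 * C * T) := by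
    have h1 : Tendsto (fun A : ℝ ↦ Real.exp (-(ν / 2) * A ^ 2) * m') atTop (𝓝 (0 * m')) := by
      refine Tendsto.mul_const _ (Real.tendsto_exp_atBot.comp ?_)
      exact (tendsto_pow_atTop two_ne_zero).const_mul_atTop_of_neg (by linarith)
    rw [zero_mul] at h1
    obtain ⟨A, hA1, hA2⟩ := ((h1.eventually (gt_mem_nhds (show 0 < m / (4 * C * T) by
      positivity))).and (eventually_gt_atTop 0)).exists
    exact ⟨A, hA2, hA1.le⟩
  set K := d * (volume.real (ball (0 : Rd d) 1) * 3 ^ d) * (2 * A * (4 * A / ε) ^ (d - 1)) with hK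
  have hK0 : 0 ≤ K := by positivity
  -- Fixed before `θ` and `r`, so it bounds the infimum; `K + 1` avoids separate treatment of `K =
  -- 0`.
  set η := m / (4 * C * T * (K + 1)) with hη
  have hη0 : 0 < η := by positivity
  have hηK : η * K ≤ m / (4 * C * T) := by
    rw [hη, div_mul_eq_mul_div, div_le_div_iff₀ (by positivity) (by positivity)]
    have : 0 ≤ m * (4 * C * T) := by positivity
    nlinarith
  refine (ENNReal.ofReal_pos.2 hη0).trans_le (le_iInf fun θ ↦ ?_)
  by_contra hlt
  rw [not_le, lowerDensity] at hlt
  obtain ⟨r, hrat, hr⟩ := ((frequently_lt_of_liminf_lt (by isBoundedDefault) hlt).and_eventually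
    (Ioc_mem_nhdsGT (show (0 : ℝ) < 1 / 2 by norm_num))).exists
  have hdens : (surf d).real (symmetrized S ∩ ball θ r) ≤ η * (surf d).real (ball θ r) := by
    rw [sphereProb_div hd, ENNReal.div_lt_iff (Or.inl (surf_ball_pos θ hr.1).ne')
      (Or.inl (measure_ne_top _ _))] at hrat
    have := ENNReal.toReal_mono (ENNReal.mul_ne_top ENNReal.ofReal_ne_top (measure_ne_top _ _))
      hrat.le
    rwa [ENNReal.toReal_mul, ENNReal.toReal_ofReal hη0.le] at this
  -- With this amplitude, `|cos (νt)| ≥ ε` places the centre at distance between `2A/r` and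
  -- `2A/(εr)` from the origin.
  set R := 2 * A / (ε * r) with hR
  have hr0 := hr.1
  have hR0 : 0 < R := by positivity
  obtain ⟨hcont, hineq⟩ := gaussian_observability hν h θ R
  set G : ℝ → ℝ := fun t ↦
    ∫ x in cone S, Real.exp (-ν * ‖x - (R * Real.cos (ν * t)) • (θ : Rd d)‖ ^ 2) with hG
  set N : Set ℝ := {t | |Real.cos (ν * t)| < ε} with hN
  have hNm : MeasurableSet N := measurableSet_lt (by fun_prop) measurable_const
  have hGb : ∀ t, G t ≤ m / (2 * C * T) + N.indicator (fun _ ↦ m) t := by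
    intro t
    by_cases ht : t ∈ N
    · rw [indicator_of_mem ht]
      have h1 := setIntegral_gaussian_le_integral hν (cone S) ((R * Real.cos (ν * t)) • (θ : Rd d))
      have h2 : 0 ≤ m / (2 * C * T) := by positivity
      linarith
    · rw [indicator_of_notMem ht, add_zero]
      have ht' : ε ≤ |Real.cos (ν * t)| := not_lt.1 ht
      have hκ : |R * Real.cos (ν * t)| = R * |Real.cos (ν * t)| := by
        rw [abs_mul, abs_of_pos hR0]
      have h1 : 2 * A / r ≤ |R * Real.cos (ν * t)| := by
        have h3 : 2 * A / r = R * ε := by rw [hR]; field_simp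
        rw [hκ, h3]
        gcongr
      have h2 : |R * Real.cos (ν * t)| ≤ R := by
        rw [hκ]
        exact mul_le_of_le_one_right hR0.le (Real.abs_cos_le_one _)
      refine (setIntegral_gaussian_cone_le hd hν hA hr.1 hr.2 hε hη0 hdens h1 h2).trans ?_
      have h3 : m / (2 * C * T) = m / (4 * C * T) + m / (4 * C * T) := by field_simp; ring
      rw [h3]
      exact add_le_add hηK hAm
  have hInt : ∫ t in (0 : ℝ)..T, G t ≤ m / (2 * C) + m * (1 / (4 * C)) := by
    rw [intervalIntegral.integral_of_le hT.le]
    have hiN : IntegrableOn (N.indicator fun _ ↦ m) (Ioc 0 T) :=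
      (integrableOn_const measure_Ioc_lt_top.ne).indicator hNm
    have hic : IntegrableOn (fun _ : ℝ ↦ m / (2 * C * T)) (Ioc 0 T) :=
      integrableOn_const measure_Ioc_lt_top.ne
    calc ∫ t in Ioc 0 T, G t ≤ ∫ t in Ioc 0 T, (m / (2 * C * T) + N.indicator (fun _ ↦ m) t) :=
          integral_mono (hcont.integrableOn_Ioc) (hic.add hiN) hGb
      _ = m / (2 * C) + volume.real (N ∩ Ioc 0 T) * m := by
          rw [integral_add hic hiN, integral_indicator_const _ hNm,
            measureReal_restrict_apply hNm, smul_eq_mul, setIntegral_const, smul_eq_mul]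
          congr 1
          rw [Real.volume_real_Ioc_of_le hT.le]
          field_simp
          ring
      _ ≤ m / (2 * C) + 1 / (4 * C) * m := by gcongr
      _ = _ := by ring
  have hfinal : m ≤ C * (m / (2 * C) + m * (1 / (4 * C))) := hineq.trans (by gcongr)
  have : C * (m / (2 * C) + m * (1 / (4 * C))) = 3 / 4 * m := by field_simp; ring
  linarith

theorem mainTheorem4 (d : ℕ) (hd : 1 ≤ d) (ν : ℝ) (hν : 0 < ν)
    (S : Set (Sph d)) (hS : NullMeasurableSet S (sphereProb d)) :
    ((∃ T : ℝ, 0 < T ∧ Observable ν (cone S) T) →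
      0 < ⨅ θ : Sph d, lowerDensity (symmetrized S) θ) ∧
    (sphereProb d (symmetrized S)ᶜ = 0 ↔
      ∀ θ : Sph d, lowerDensity (symmetrized S) θ = 1) ∧
    (sphereProb d (symmetrized S)ᶜ = 0 →
      (∃ T : ℝ, 0 < T ∧ Observable ν (cone S) T) ∧
        optimalTime ν (cone S) < 2 * Real.pi / ν) := by
  refine ⟨?_, ⟨lowerDensity_eq_one_of_full hd,
    full_of_lowerDensity_eq_one hd (nullMeasurableSet_symmetrized hS)⟩, fun h ↦ ?_⟩
  · rintro ⟨T, hT, hobs⟩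
    exact lowerDensity_lower_bound_of_observable hd hν hT hobs
  · have hπ := Real.pi_pos
    have hmem : 0 < 3 * Real.pi / (2 * ν) ∧ Observable ν (cone S) (3 * Real.pi / (2 * ν)) :=
      ⟨by positivity, observable_of_symmetric_full hν (volume_compl_cone_union_neg hd h)⟩
    refine ⟨⟨_, hmem⟩, ?_⟩
    have hle : optimalTime ν (cone S) ≤ 3 * Real.pi / (2 * ν) :=
      csInf_le ⟨0, fun T hT ↦ hT.1.le⟩ hmem
    refine hle.trans_lt ?_
    rw [div_lt_div_iff₀ (by positivity) hν]
    nlinarith [mul_pos hπ hν]
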